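/- Let $d\ge 1$. For $h>0$ and real functions $u=(u_j)_{j\in\mathbb Z^d}$ on the lattice $(h\mathbb Z)^d$, $u_j=u(hj)$, put $\Delta_{\mathrm d}u_j=h^{-2}\sum_{k=1}^d(u_{j+e_k}-2u_j+u_{j-e_k})$, and let $|\cdot|$ denote the Euclidean norm. Write $$B_r(u)=h^d\sum_{|hj|<r}|u_j|^2,\qquad A_R(u)=h^d\sum_{R-2<|hj|<R+1}|u_j|^2 .$$ Let $V:(h\mathbb Z)^d\to\mathbb R$ be bounded with $\|V\|_\infty\le M$, and let $u\in\ell^2((h\mathbb Z)^d)$ be a real solution of $\Delta_{\mathrm d}u_j+V_ju_j=0$, $j\in\mathbb Z^d$. A nontrivial $u$ has $B_{R-1}(u)\ge c$ for some $c>0$ and all large $R$; the bounds below are uniform over all $u$ with the same $c$ (one may normalise to $c=1$). 1. (Case $hR^{1/3}\le 1$.) There is a constant $C=C(d,M)>0$ such that for every $c>0$ there is $R_0=R_0(d,M,c)>0$ such that, for all $h>0$ and $R\ge R_0$ with $hR^{1/3}\le 1$ and all such $V,u$ with $B_{R-1}(u)\ge c$, $$e^{-CR^{4/3}}\le A_R(u).$$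 2. (Case $hR^{1/3}>1$.) There is a constant $C=C(d)>0$ with the following properties. (a) For all $M$ and $c>0$ there is $R_0=R_0(d,M,c)>0$ such that, for all $h>0$ and $R\ge R_0$ with $hR^{1/3}>1$ and all such $V,u$ with $B_{R-1}(u)\ge c$: if $h<1$, then $R=h^{-\beta}$ for some $\beta>3$ and $$e^{-CR^{1+1/\beta}\log(R^{1-1/\beta})}\le A_R(u);$$ and if $h<3/2$, then $e^{-C\frac Rh\log(Rh)}\le A_R(u)$. (b) For each fixed $h\in(0,3/2)$, each bounded $V$ and each nontrivial such $u$, there is $R_0>0$ such that $e^{-C\frac Rh\log(Rh)}\le A_R(u)$ for all $R\ge R_0$. -/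

import Mathlib

namespace LatticeSchrodinger

/-- Functions on the lattice `(hℤ)^d` are indexed by `j : Fin d → ℤ`, with `u j` standing for the
value at the point `h j`. `absPt h j` is the Euclidean length `|hj|`. -/
noncomputable def absPt {d : ℕ} (h : ℝ) (j : Fin d → ℤ) : ℝ :=
  ‖WithLp.toLp 2 (fun k => h * (j k : ℝ))‖

/-- The normalised discrete Laplacian on `(hℤ)^d`. -/
noncomputable def discreteLaplacian {d : ℕ} (h : ℝ) (u : (Fin d → ℤ) → ℝ) (j : Fin d → ℤ) : ℝ :=
  ∑ k : Fin d, (u (j + Pi.single k 1) - 2 * u j + u (j - Pi.single k 1)) / h ^ 2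

/-- `u ∈ ℓ²((hℤ)^d)` solves `Δ_d u + V u = 0` on the whole lattice. -/
def IsSolution {d : ℕ} (h : ℝ) (V u : (Fin d → ℤ) → ℝ) : Prop :=
  Memℓp u 2 ∧ ∀ j, discreteLaplacian h u j + V j * u j = 0

/-- `h^d ∑_{R-2 < |hj| < R+1} |u_j|²`. For `h > 0` the sum is finite. -/
noncomputable def annulusMass {d : ℕ} (h R : ℝ) (u : (Fin d → ℤ) → ℝ) : ℝ :=
  h ^ d * ∑' j : {j : Fin d → ℤ // R - 2 < absPt h j ∧ absPt h j < R + 1}, |u j| ^ 2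

/-- `h^d ∑_{|hj| < r} |u_j|²`. For `h > 0` the sum is finite. -/
noncomputable def ballMass {d : ℕ} (h r : ℝ) (u : (Fin d → ℤ) → ℝ) : ℝ :=
  h ^ d * ∑' j : {j : Fin d → ℤ // absPt h j < r}, |u j| ^ 2

end LatticeSchrodinger

/-!
Everything rests on a Carleman estimate for the lattice Laplacian with a weight `e^φ`, where `φ` is
a convex quadratic function of a single coordinate `j_i`. Conjugating the Laplacian by `e^φ` splits
it into a symmetric and a skew part, and their commutator is bounded below by a discrete version of
`φ'' φ'^2`. If the slope of `φ` on the slab `|j_i| ≤ (R + 1) / h` is of size `Θ`, this lower bound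
beats the potential as soon as `h^4 (M^2 + 1) ≤ 4 sinh (Θ h / (R + 1)) sinh^2 Θ`.

The estimate is applied to `χ u`, where `χ` is a cutoff at `|hj| ≈ R`. Then `Δ(χ u) + V χ u` is the
commutator `[Δ, χ] u`, which lives in the annulus, and the oscillation of `φ` costs a factor
`e^{C Θ R / h}`.

* On a fine mesh, `h R^{1/3} ≤ 1`, one takes `Θ ≈ h R^{1/3}`, which costs `e^{C R^{4/3}}`. A smooth
  cutoff and a Caccioppoli estimate make `[Δ, χ] u` of order `h^2`, so all powers of `h` cancel.
* On a coarse mesh one takes `Θ = log (R h)` and a sharp cutoff. The lost factor `h^{-4}` is at most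
  `R^{4/3}`, which the exponential absorbs.
-/

namespace LatticeSchrodinger

open Finset Function

section Translation

variable {G : Type*} [AddCommGroup G]

lemma summable_of_forall_comp_add_eq_zero {F w : G → ℝ} (hw : w.HasFiniteSupport) (a : G)
    (hF : ∀ j, w (j + a) = 0 → F j = 0) : Summable F :=
  summable_of_hasFiniteSupport <|
    (hw.preimage (add_left_injective a).injOn).subset fun j hj h => hj (hF j h)

lemma hasSum_sub_comp_add {F : G → ℝ} (hF : Summable F) (a : G) :
    HasSum (fun j => F j - F (j + a)) 0 := by
  simpa using hF.hasSum.sub ((Equiv.addRight a).hasSum_iff.2 hF.hasSum)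

lemma hasSum_comp_sub_sub {F : G → ℝ} (hF : Summable F) (a : G) :
    HasSum (fun j => F (j - a) - F j) 0 := by
  simpa using ((Equiv.subRight a).hasSum_iff.2 hF.hasSum).sub hF.hasSum

end Translation

section Carleman

variable {ι : Type*} [DecidableEq ι]

/-- The `k`-th unit vector of the lattice `ℤ^ι`. -/
def unitVec (k : ι) : ι → ℤ := Pi.single k 1

lemma unitVec_same (k : ι) : unitVec k k = 1 := Pi.single_eq_same k 1

lemma unitVec_of_ne {i k : ι} (hk : k ≠ i) : unitVec k i = 0 := Pi.single_eq_of_ne hk.symm 1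

/-- The antisymmetric part of the second difference in direction `i`, conjugated by `e^φ` for a
weight `φ(j_i)` with slopes `θ n = φ (n + 1) - φ n`. -/
noncomputable def skewPart (i : ι) (θ : ℤ → ℝ) (w : (ι → ℤ) → ℝ) (j : ι → ℤ) : ℝ :=
  Real.sinh (θ (j i - 1)) * w (j - unitVec i) - Real.sinh (θ (j i)) * w (j + unitVec i)

/-- The off-diagonal symmetric part of the second difference in direction `i`, conjugated by `e^φ`
for a weight `φ(j_i)` with slopes `θ n = φ (n + 1) - φ n`. -/
noncomputable def symmPart (i : ι) (θ : ℤ → ℝ) (w : (ι → ℤ) → ℝ) (j : ι → ℤ) : ℝ :=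
  Real.cosh (θ (j i - 1)) * w (j - unitVec i) + Real.cosh (θ (j i)) * w (j + unitVec i)

/-- The positivity produced by the commutator of `symmPart` and `skewPart`, after the off-diagonal
terms are absorbed: a discrete counterpart of `φ'' φ'^2`. -/
noncomputable def carlemanGain (θ : ℤ → ℝ) (n : ℤ) : ℝ :=
  Real.sinh (θ n - θ (n - 1)) * Real.cosh (θ n + θ (n - 1)) -
    (Real.sinh (θ (n + 1) - θ n) + Real.sinh (θ (n - 1) - θ (n - 2))) / 2

lemma hasSum_mul_skewPart (i : ι) (θ : ℤ → ℝ) {w : (ι → ℤ) → ℝ} (hw : w.HasFiniteSupport) :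
    HasSum (fun j => w j * skewPart i θ w j) 0 := by
  have hF : Summable fun j => Real.sinh (θ (j i)) * w j * w (j + unitVec i) :=
    summable_of_forall_comp_add_eq_zero hw (unitVec i) fun j hj => by simp [hj]
  refine (hasSum_comp_sub_sub hF (unitVec i)).congr_fun fun j => ?_
  simp only [skewPart, Pi.sub_apply, unitVec_same, sub_add_cancel]
  ring

lemma hasSum_translate_mul_skewPart (i : ι) (θ : ℤ → ℝ) {w : (ι → ℤ) → ℝ}
    (hw : w.HasFiniteSupport) {a : ι → ℤ} (ha : a i = 0) :
    HasSum (fun j => (w (j + a) + w (j - a)) * skewPart i θ w j) 0 := by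
  have hF (b : ι → ℤ) :
      Summable fun j => Real.sinh (θ (j i)) * w (j + b) * w (j + unitVec i) :=
    summable_of_forall_comp_add_eq_zero hw (unitVec i) fun j hj => by simp [hj]
  have hplus := hasSum_comp_sub_sub (hF a) (unitVec i + a)
  have hminus := hasSum_comp_sub_sub (hF (-a)) (unitVec i - a)
  rw [← add_zero (0 : ℝ)]
  refine (hplus.add hminus).congr_fun fun j => ?_
  have h₁ : j - (unitVec i + a) + a = j - unitVec i := by abel
  have h₂ : j - (unitVec i + a) + unitVec i = j - a := by abel
  have h₃ : j - (unitVec i - a) + -a = j - unitVec i := by abel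
  have h₄ : j - (unitVec i - a) + unitVec i = j + a := by abel
  simp only [skewPart, h₁, h₂, h₃, h₄, ← sub_eq_add_neg, Pi.sub_apply, Pi.add_apply, ha,
    unitVec_same, add_zero, sub_zero]
  ring

lemma sinh_sub_mul_cosh_add (x y : ℝ) :
    Real.sinh (x - y) * Real.cosh (x + y) =
      Real.cosh x * Real.sinh x - Real.cosh y * Real.sinh y := by
  rw [Real.sinh_sub, Real.cosh_add]
  linear_combination Real.sinh x * Real.cosh x * Real.cosh_sq y -
    Real.sinh y * Real.cosh y * Real.cosh_sq x

lemma summable_symmPart_mul_skewPart (i : ι) (θ : ℤ → ℝ) {w : (ι → ℤ) → ℝ}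
    (hw : w.HasFiniteSupport) : Summable fun j => symmPart i θ w j * skewPart i θ w j := by
  have hplus : Summable fun j => Real.cosh (θ (j i)) * w (j + unitVec i) * skewPart i θ w j :=
    summable_of_forall_comp_add_eq_zero hw (unitVec i) fun j hj => by simp [hj]
  have hminus : Summable fun j =>
      Real.cosh (θ (j i - 1)) * w (j - unitVec i) * skewPart i θ w j :=
    summable_of_forall_comp_add_eq_zero hw (-unitVec i) fun j hj => by
      simp [sub_eq_add_neg, hj]
  exact (hminus.add hplus).congr fun j => (add_mul _ _ _).symm

lemma tsum_carlemanGain_mul_sq_le (i : ι) {θ : ℤ → ℝ} (hθ : Monotone θ) {w : (ι → ℤ) → ℝ}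
    (hw : w.HasFiniteSupport) :
    ∑' j, carlemanGain θ (j i) * w j ^ 2 ≤ ∑' j, symmPart i θ w j * skewPart i θ w j := by
  let P (n : ℤ) : ℝ := Real.cosh (θ n) * Real.sinh (θ n)
  let s (n : ℤ) : ℝ := Real.sinh (θ n - θ (n - 1))
  have hsum (c : ℤ → ℝ) : Summable fun j => c (j i) * w j ^ 2 :=
    summable_of_forall_comp_add_eq_zero hw 0 fun j hj => by simp_all
  have htele := (hasSum_comp_sub_sub (hsum fun n => P n - s (n + 1) / 2) (unitVec i)).add
    (hasSum_sub_comp_add (hsum fun n => P (n - 1) + s (n - 1) / 2) (unitVec i))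
  have hle := htele.summable.add (hsum (carlemanGain θ)) |>.tsum_le_tsum (fun j => ?_)
    (summable_symmPart_mul_skewPart i θ hw)
  · rwa [htele.summable.tsum_add (hsum _), htele.tsum_eq, add_zero, zero_add] at hle
  have hs : 0 ≤ s (j i) := Real.sinh_nonneg_iff.2 (sub_nonneg.2 (hθ (by lia)))
  have hgain : carlemanGain θ (j i) =
      P (j i) - P (j i - 1) - (s (j i + 1) + s (j i - 1)) / 2 := by
    simp only [carlemanGain, sinh_sub_mul_cosh_add, P, s, add_sub_cancel_right, sub_sub,
      one_add_one_eq_two]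
  have hexp : symmPart i θ w j * skewPart i θ w j = P (j i - 1) * w (j - unitVec i) ^ 2 -
      P (j i) * w (j + unitVec i) ^ 2 - s (j i) * (w (j + unitVec i) * w (j - unitVec i)) := by
    simp only [symmPart, skewPart, P, s, Real.sinh_sub]
    ring
  rw [hgain, hexp]
  simp only [Pi.sub_apply, Pi.add_apply, unitVec_same, sub_add_cancel, add_sub_cancel_right]
  linear_combination s (j i) / 2 * sq_nonneg (w (j + unitVec i) - w (j - unitVec i))

variable [Fintype ι]

/-- The unscaled Laplacian of the lattice `ℤ^ι`. -/
def latticeLaplacian (v : (ι → ℤ) → ℝ) (j : ι → ℤ) : ℝ :=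
  ∑ k, (v (j + unitVec k) - 2 * v j + v (j - unitVec k))

/-- The symmetric part of the conjugated Laplacian that is not in direction `i`, where the weight
acts: the neighbours in the other directions, and the diagonal of all directions. -/
def transversePart (i : ι) (w : (ι → ℤ) → ℝ) (j : ι → ℤ) : ℝ :=
  ∑ k ∈ univ.erase i, (w (j + unitVec k) + w (j - unitVec k)) - 2 * Fintype.card ι * w j

lemma hasSum_transversePart_mul_skewPart (i : ι) (θ : ℤ → ℝ) {w : (ι → ℤ) → ℝ}
    (hw : w.HasFiniteSupport) :
    HasSum (fun j => transversePart i w j * skewPart i θ w j) 0 := by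
  have htranslate := hasSum_sum (s := univ.erase i) fun k hk =>
    hasSum_translate_mul_skewPart i θ hw (unitVec_of_ne (ne_of_mem_erase hk))
  have hdiag := (hasSum_mul_skewPart i θ hw).mul_left (2 * (Fintype.card ι : ℝ))
  have hsub := htranslate.sub hdiag
  rw [sum_const_zero, mul_zero, sub_zero] at hsub
  refine hsub.congr_fun fun j => ?_
  rw [transversePart, sub_mul, sum_mul, mul_assoc]

lemma exp_mul_latticeLaplacian (i : ι) {φ θ : ℤ → ℝ} (hφ : ∀ n, φ (n + 1) - φ n = θ n)
    (v : (ι → ℤ) → ℝ) (j : ι → ℤ) :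
    let w : (ι → ℤ) → ℝ := fun j => Real.exp (φ (j i)) * v j
    Real.exp (φ (j i)) * latticeLaplacian v j =
      symmPart i θ w j + transversePart i w j + skewPart i θ w j := by
  intro w
  have hforward : Real.exp (φ (j i)) * v (j + unitVec i) =
      (Real.cosh (θ (j i)) - Real.sinh (θ (j i))) * w (j + unitVec i) := by
    rw [Real.cosh_sub_sinh, ← hφ]
    simp only [w, Pi.add_apply, unitVec_same]
    rw [← mul_assoc, ← Real.exp_add]
    ring_nf
  have hbackward : Real.exp (φ (j i)) * v (j - unitVec i) =
      (Real.cosh (θ (j i - 1)) + Real.sinh (θ (j i - 1))) * w (j - unitVec i) := by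
    rw [Real.cosh_add_sinh, ← hφ]
    simp only [w, Pi.sub_apply, unitVec_same]
    rw [← mul_assoc, ← Real.exp_add]
    ring_nf
  have htransverse (k) (hk : k ∈ univ.erase i) :
      Real.exp (φ (j i)) * (v (j + unitVec k) + v (j - unitVec k)) =
        w (j + unitVec k) + w (j - unitVec k) := by
    simp only [w, Pi.add_apply, Pi.sub_apply, unitVec_of_ne (ne_of_mem_erase hk), add_zero,
      sub_zero, mul_add]
  have hlaplacian : latticeLaplacian v j = ∑ k ∈ univ.erase i,
      (v (j + unitVec k) + v (j - unitVec k)) + (v (j + unitVec i) + v (j - unitVec i)) -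
        2 * Fintype.card ι * v j := by
    rw [sum_erase_add _ _ (mem_univ i), latticeLaplacian]
    simp only [sum_add_distrib, sum_sub_distrib, sum_const, card_univ, nsmul_eq_mul]
    ring
  rw [hlaplacian, transversePart, ← sum_congr rfl htransverse, ← mul_sum]
  simp only [symmPart, skewPart]
  linear_combination hforward + hbackward

lemma hasFiniteSupport_latticeLaplacian {v : (ι → ℤ) → ℝ} (hv : v.HasFiniteSupport) :
    (latticeLaplacian v).HasFiniteSupport := by
  have hplus (k : ι) : (fun j => v (j + unitVec k)).HasFiniteSupport :=
    hv.fun_comp_of_injective (add_left_injective _)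
  have hminus (k : ι) : (fun j => v (j - unitVec k)).HasFiniteSupport :=
    hv.fun_comp_of_injective sub_left_injective
  exact HasFiniteSupport.sum (fun k => ((hplus k).fun_sub (hv.fun_mul_right _)).fun_add
    (hminus k)) univ

theorem carleman_estimate (i : ι) {φ θ : ℤ → ℝ} (hφ : ∀ n, φ (n + 1) - φ n = θ n)
    (hθ : Monotone θ) {v : (ι → ℤ) → ℝ} (hv : v.HasFiniteSupport) :
    4 * ∑' j, carlemanGain θ (j i) * (Real.exp (φ (j i)) * v j) ^ 2 ≤
      ∑' j, (Real.exp (φ (j i)) * latticeLaplacian v j) ^ 2 := by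
  set w : (ι → ℤ) → ℝ := fun j => Real.exp (φ (j i)) * v j
  have hwfin : w.HasFiniteSupport := hv.mul_right _
  have hsymm := (summable_symmPart_mul_skewPart i θ hwfin).mul_left 4
  have htrans := (hasSum_transversePart_mul_skewPart i θ hwfin).mul_left 4
  calc 4 * ∑' j, carlemanGain θ (j i) * w j ^ 2
      ≤ 4 * ∑' j, symmPart i θ w j * skewPart i θ w j := by
        gcongr 4 * ?_
        exact tsum_carlemanGain_mul_sq_le i hθ hwfin
    _ = ∑' j, (4 * (symmPart i θ w j * skewPart i θ w j) +
          4 * (transversePart i w j * skewPart i θ w j)) := by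
        rw [hsymm.tsum_add htrans.summable, htrans.tsum_eq, tsum_mul_left, mul_zero, add_zero]
    _ ≤ ∑' j, (Real.exp (φ (j i)) * latticeLaplacian v j) ^ 2 := by
        refine (hsymm.add htrans.summable).tsum_le_tsum (fun j => ?_)
          (summable_of_forall_comp_add_eq_zero (hasFiniteSupport_latticeLaplacian hv) 0
            fun j hj => by simp_all)
        rw [exp_mul_latticeLaplacian i hφ]
        linear_combination
          sq_nonneg (symmPart i θ w j + transversePart i w j - skewPart i θ w j)

end Carleman

section WeightedBound

variable {ι : Type*}

/-- The quadratic Carleman weight, as a function of one coordinate. -/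
noncomputable def quadraticWeight (α η : ℝ) (n : ℤ) : ℝ := α * n + η * n ^ 2 / 2

lemma abs_quadraticWeight_le {N Θ : ℝ} (hN : 0 < N) (hΘ : 0 ≤ Θ) {n : ℤ} (hn : |(n : ℝ)| ≤ N) :
    |quadraticWeight (2 * Θ) (Θ / N) n| ≤ 5 / 2 * (Θ * N) := by
  have hsq : (n : ℝ) ^ 2 ≤ N ^ 2 := sq_le_sq.2 (by rwa [abs_of_pos hN])
  calc |quadraticWeight (2 * Θ) (Θ / N) n|
      ≤ |2 * Θ * n| + |Θ / N * n ^ 2 / 2| := abs_add_le _ _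
    _ = 2 * Θ * |(n : ℝ)| + Θ / N * n ^ 2 / 2 := by
        rw [abs_mul, abs_of_nonneg (by positivity : 0 ≤ 2 * Θ),
          abs_of_nonneg (by positivity : 0 ≤ Θ / N * (n : ℝ) ^ 2 / 2)]
    _ ≤ 2 * Θ * N + Θ / N * N ^ 2 / 2 := by gcongr
    _ = 5 / 2 * (Θ * N) := by field_simp; norm_num

lemma exp_quadraticWeight_sq_le {N Θ : ℝ} (hN : 0 < N) (hΘ : 0 ≤ Θ) {n : ℤ}
    (hn : |(n : ℝ)| ≤ N) :
    Real.exp (quadraticWeight (2 * Θ) (Θ / N) n) ^ 2 ≤ Real.exp (5 * (Θ * N)) := by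
  rw [← Real.exp_nat_mul, Nat.cast_two, Real.exp_le_exp]
  linarith [(abs_le.1 (abs_quadraticWeight_le hN hΘ hn)).2]

lemma one_le_exp_mul_exp_quadraticWeight_sq {N Θ : ℝ} (hN : 0 < N) (hΘ : 0 ≤ Θ) {n : ℤ}
    (hn : |(n : ℝ)| ≤ N) :
    1 ≤ Real.exp (5 * (Θ * N)) * Real.exp (quadraticWeight (2 * Θ) (Θ / N) n) ^ 2 := by
  rw [← Real.exp_nat_mul, Nat.cast_two, ← Real.exp_add, Real.one_le_exp_iff]
  linarith [(abs_le.1 (abs_quadraticWeight_le hN hΘ hn)).1]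

variable [DecidableEq ι] [Fintype ι]

lemma carleman_estimate_quadraticWeight (i : ι) (α : ℝ) {η : ℝ} (hη : 0 ≤ η)
    {v : (ι → ℤ) → ℝ} (hv : v.HasFiniteSupport) :
    8 * Real.sinh η * ∑' j, Real.sinh (α + η * j i) ^ 2 *
        (Real.exp (quadraticWeight α η (j i)) * v j) ^ 2 ≤
      ∑' j, (Real.exp (quadraticWeight α η (j i)) * latticeLaplacian v j) ^ 2 := by
  let θ (n : ℤ) : ℝ := α + η * (n + 1 / 2)
  have hslope (n : ℤ) : quadraticWeight α η (n + 1) - quadraticWeight α η n = θ n := by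
    simp only [quadraticWeight, θ]
    push_cast
    ring
  have hmono : Monotone θ := fun m n hmn => by
    simp only [θ]
    gcongr
  have hgain (n : ℤ) :
      carlemanGain θ n = 2 * Real.sinh η * Real.sinh (α + η * n) ^ 2 := by
    have hdiff (x y : ℤ) (hxy : x = y + 1) : θ x - θ y = η := by
      simp only [θ, hxy]
      push_cast
      ring
    have hsum : θ n + θ (n - 1) = 2 * (α + η * n) := by
      simp only [θ]
      push_cast
      ring
    rw [carlemanGain, hdiff n (n - 1) (by ring), hdiff (n + 1) n rfl,
      hdiff (n - 1) (n - 2) (by ring), hsum, Real.cosh_two_mul, Real.cosh_sq]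
    ring
  refine le_of_eq_of_le ?_ (carleman_estimate i hslope hmono hv)
  simp only [hgain, mul_assoc, tsum_mul_left]
  ring

/-- The weight `quadraticWeight (2Θ) (Θ/N)` has slope at least `Θ` on the slab `|j_i| ≤ N`. -/
lemma mul_tsum_exp_mul_sq_le_tsum_laplacian (i : ι) {N Θ : ℝ} (hN : 0 < N) (hΘ : 0 ≤ Θ)
    {v : (ι → ℤ) → ℝ} (hv : v.HasFiniteSupport) (hvN : ∀ j, v j ≠ 0 → |(j i : ℝ)| ≤ N) :
    let φ := quadraticWeight (2 * Θ) (Θ / N)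
    8 * Real.sinh (Θ / N) * Real.sinh Θ ^ 2 * ∑' j, (Real.exp (φ (j i)) * v j) ^ 2 ≤
      ∑' j, (Real.exp (φ (j i)) * latticeLaplacian v j) ^ 2 := by
  intro φ
  have : 0 ≤ Real.sinh (Θ / N) := Real.sinh_nonneg_iff.2 (by positivity)
  have hsum (c : (ι → ℤ) → ℝ) : Summable fun j => c j * (Real.exp (φ (j i)) * v j) ^ 2 :=
    summable_of_forall_comp_add_eq_zero hv 0 fun j hj => by simp_all
  refine le_trans ?_ (carleman_estimate_quadraticWeight i (2 * Θ) (η := Θ / N)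
    (by positivity) hv)
  rw [mul_assoc, ← tsum_mul_left]
  gcongr 8 * Real.sinh (Θ / N) * ?_
  refine (hsum _).tsum_le_tsum (fun j => ?_) (hsum _)
  rcases eq_or_ne (v j) 0 with hj | hj
  · simp [hj]
  have hslope : Θ ≤ 2 * Θ + Θ / N * j i := by
    have : -N ≤ j i := (abs_le.1 (hvN j hj)).1
    calc Θ = 2 * Θ + Θ / N * -N := by field_simp; norm_num
      _ ≤ 2 * Θ + Θ / N * j i := by gcongr
  have := Real.sinh_le_sinh.2 hslope
  have := Real.sinh_nonneg_iff.2 hΘ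
  gcongr

lemma mul_tsum_exp_mul_sq_le (i : ι) {N Θ m δ : ℝ} (hN : 0 < N) (hΘ : 0 ≤ Θ)
    (hδ : m ^ 2 + δ ≤ 4 * Real.sinh (Θ / N) * Real.sinh Θ ^ 2) {W v : (ι → ℤ) → ℝ}
    (hW : ∀ j, |W j| ≤ m) (hv : v.HasFiniteSupport) (hvN : ∀ j, v j ≠ 0 → |(j i : ℝ)| ≤ N) :
    let φ := quadraticWeight (2 * Θ) (Θ / N)
    δ * ∑' j, (Real.exp (φ (j i)) * v j) ^ 2 ≤
      ∑' j, (Real.exp (φ (j i)) * (latticeLaplacian v j + W j * v j)) ^ 2 := by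
  intro φ
  set w : (ι → ℤ) → ℝ := fun j => Real.exp (φ (j i)) * v j
  set g : (ι → ℤ) → ℝ := fun j =>
    Real.exp (φ (j i)) * (latticeLaplacian v j + W j * v j)
  have hw_summable (c : (ι → ℤ) → ℝ) : Summable fun j => c j * w j ^ 2 :=
    summable_of_forall_comp_add_eq_zero hv 0 fun j hj => by
      rw [add_zero] at hj
      simp only [w, hj, mul_zero, zero_pow two_ne_zero]
  have hlap := hasFiniteSupport_latticeLaplacian hv
  have hg_summable : Summable fun j => g j ^ 2 :=
    summable_of_hasFiniteSupport (HasFiniteSupport.fun_comp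
      (((hlap.fun_add (hv.fun_mul_right W)).fun_mul_right _)) (zero_pow two_ne_zero))
  have hupper : ∑' j, (Real.exp (φ (j i)) * latticeLaplacian v j) ^ 2 ≤
      2 * ∑' j, g j ^ 2 + 2 * m ^ 2 * ∑' j, w j ^ 2 := by
    rw [← tsum_mul_left, ← tsum_mul_left,
      ← (hg_summable.mul_left 2).tsum_add (hw_summable fun _ => 2 * m ^ 2)]
    refine Summable.tsum_le_tsum (fun j => ?_)
      (summable_of_forall_comp_add_eq_zero hlap 0 fun j hj => by simp_all)
      ((hg_summable.mul_left 2).add (hw_summable fun _ => 2 * m ^ 2))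
    have hWm : W j ^ 2 ≤ m ^ 2 := sq_le_sq.2 ((hW j).trans (le_abs_self m))
    have hsplit : Real.exp (φ (j i)) * latticeLaplacian v j = g j - W j * w j := by
      simp only [g, w]
      ring
    rw [hsplit]
    linear_combination sq_nonneg (g j + W j * w j) + 2 * w j ^ 2 * hWm
  have : 0 ≤ ∑' j, w j ^ 2 := tsum_nonneg fun j => sq_nonneg _
  linear_combination mul_tsum_exp_mul_sq_le_tsum_laplacian i hN hΘ hv hvN / 2 +
    hupper / 2 + (∑' j, w j ^ 2) * hδ

theorem mul_tsum_sq_le_exp_mul (i : ι) {N Θ m δ : ℝ} (hN : 0 < N) (hΘ : 0 ≤ Θ) (hδ₀ : 0 ≤ δ)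
    (hδ : m ^ 2 + δ ≤ 4 * Real.sinh (Θ / N) * Real.sinh Θ ^ 2) {W v : (ι → ℤ) → ℝ}
    (hW : ∀ j, |W j| ≤ m) (hv : v.HasFiniteSupport) (hvN : ∀ j, v j ≠ 0 → |(j i : ℝ)| ≤ N)
    (hfN : ∀ j, latticeLaplacian v j + W j * v j ≠ 0 → |(j i : ℝ)| ≤ N) :
    δ * ∑' j, v j ^ 2 ≤
      Real.exp (10 * (Θ * N)) * ∑' j, (latticeLaplacian v j + W j * v j) ^ 2 := by
  set φ := quadraticWeight (2 * Θ) (Θ / N)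
  set f : (ι → ℤ) → ℝ := fun j => latticeLaplacian v j + W j * v j
  set E := Real.exp (5 * (Θ * N)) with hE
  have hf_fin : f.HasFiniteSupport :=
    (hasFiniteSupport_latticeLaplacian hv).fun_add (hv.fun_mul_right W)
  have summable_sq {g : (ι → ℤ) → ℝ} (hg : g.HasFiniteSupport) (c : (ι → ℤ) → ℝ) :
      Summable fun j => c j * g j ^ 2 :=
    summable_of_forall_comp_add_eq_zero hg 0 fun j hj => by simp_all
  have hv_le : ∑' j, v j ^ 2 ≤ E * ∑' j, (Real.exp (φ (j i)) * v j) ^ 2 := by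
    simp only [mul_pow, ← tsum_mul_left, ← mul_assoc]
    refine Summable.tsum_le_tsum (fun j => ?_) (by simpa using summable_sq hv fun _ => 1)
      (summable_sq hv _)
    rcases eq_or_ne (v j) 0 with hj | hj
    · simp [hj]
    · exact le_mul_of_one_le_left (sq_nonneg _)
        (one_le_exp_mul_exp_quadraticWeight_sq hN hΘ (hvN j hj))
  have hf_le : ∑' j, (Real.exp (φ (j i)) * f j) ^ 2 ≤ E * ∑' j, f j ^ 2 := by
    simp only [mul_pow, ← tsum_mul_left]
    refine (summable_sq hf_fin _).tsum_le_tsum (fun j => ?_) (summable_sq hf_fin _)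
    rcases eq_or_ne (f j) 0 with hj | hj
    · simp [hj]
    · exact mul_le_mul_of_nonneg_right (exp_quadraticWeight_sq_le hN hΘ (hfN j hj))
        (sq_nonneg _)
  calc δ * ∑' j, v j ^ 2
      ≤ δ * (E * ∑' j, (Real.exp (φ (j i)) * v j) ^ 2) := by gcongr
    _ = E * (δ * ∑' j, (Real.exp (φ (j i)) * v j) ^ 2) := mul_left_comm _ _ _
    _ ≤ E * (E * ∑' j, f j ^ 2) := by
        gcongr E * ?_
        exact (mul_tsum_exp_mul_sq_le i hN hΘ hδ hW hv hvN).trans hf_le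
    _ = Real.exp (10 * (Θ * N)) * ∑' j, f j ^ 2 := by
        rw [← mul_assoc, hE, ← Real.exp_add]
        ring_nf

end WeightedBound

section Commutator

variable {ι : Type*} [DecidableEq ι] [Fintype ι]

/-- The commutator `[Δ, χ] u` of the unscaled Laplacian with multiplication by `χ`. -/
def laplacianCommutator (χ u : (ι → ℤ) → ℝ) (j : ι → ℤ) : ℝ :=
  latticeLaplacian (fun j => χ j * u j) j - χ j * latticeLaplacian u j

lemma laplacianCommutator_eq_sum (χ u : (ι → ℤ) → ℝ) (j : ι → ℤ) :
    laplacianCommutator χ u j = ∑ k, ((χ (j + unitVec k) - χ j) * u (j + unitVec k) +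
      (χ (j - unitVec k) - χ j) * u (j - unitVec k)) := by
  rw [laplacianCommutator, latticeLaplacian, latticeLaplacian, mul_sum, ← sum_sub_distrib]
  exact sum_congr rfl fun k _ => by ring

lemma laplacianCommutator_eq_zero {χ u : (ι → ℤ) → ℝ} {j : ι → ℤ}
    (hplus : ∀ k, χ (j + unitVec k) = χ j) (hminus : ∀ k, χ (j - unitVec k) = χ j) :
    laplacianCommutator χ u j = 0 := by
  simp [laplacianCommutator_eq_sum, hplus, hminus]

lemma laplacianCommutator_congr {χ u g : (ι → ℤ) → ℝ} {j : ι → ℤ}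
    (hplus : ∀ k, u (j + unitVec k) = g (j + unitVec k))
    (hminus : ∀ k, u (j - unitVec k) = g (j - unitVec k)) :
    laplacianCommutator χ u j = laplacianCommutator χ g j := by
  simp [laplacianCommutator_eq_sum, hplus, hminus]

end Commutator

section Geometry

variable {d : ℕ}

lemma discreteLaplacian_eq_div (h : ℝ) (u : (Fin d → ℤ) → ℝ) (j : Fin d → ℤ) :
    discreteLaplacian h u j = latticeLaplacian u j / h ^ 2 := by
  simp only [discreteLaplacian, latticeLaplacian, sum_div, unitVec]

/-- The point `hj` of Euclidean space, whose norm is `absPt h j`. -/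
noncomputable def latticePoint (h : ℝ) (j : Fin d → ℤ) : EuclideanSpace ℝ (Fin d) :=
  WithLp.toLp 2 fun k => h * (j k : ℝ)

lemma norm_latticePoint (h : ℝ) (j : Fin d → ℤ) : ‖latticePoint h j‖ = absPt h j := rfl

lemma latticePoint_add_unitVec (h : ℝ) (j : Fin d → ℤ) (k : Fin d) :
    latticePoint h (j + unitVec k) = latticePoint h j + EuclideanSpace.single k h := by
  ext l
  by_cases hl : l = k <;> simp [latticePoint, unitVec, hl, mul_add]

lemma absPt_nonneg (h : ℝ) (j : Fin d → ℤ) : 0 ≤ absPt h j := norm_nonneg _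

lemma abs_mul_coord_le_absPt (h : ℝ) (j : Fin d → ℤ) (k : Fin d) :
    |h * (j k : ℝ)| ≤ absPt h j :=
  PiLp.norm_apply_le (latticePoint h j) k

lemma absPt_add_unitVec_sq (h : ℝ) (j : Fin d → ℤ) (k : Fin d) :
    absPt h (j + unitVec k) ^ 2 = absPt h j ^ 2 + 2 * (h * (h * j k)) + h ^ 2 := by
  rw [← norm_latticePoint, latticePoint_add_unitVec, norm_add_sq_real,
    EuclideanSpace.inner_single_right, PiLp.norm_single, Real.norm_eq_abs, sq_abs]
  rfl

lemma absPt_sub_unitVec_sq (h : ℝ) (j : Fin d → ℤ) (k : Fin d) :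
    absPt h (j - unitVec k) ^ 2 = absPt h j ^ 2 - 2 * (h * (h * j k)) + h ^ 2 := by
  have hsq := absPt_add_unitVec_sq h (j - unitVec k) k
  rw [sub_add_cancel, Pi.sub_apply, unitVec_same] at hsq
  push_cast at hsq
  linarith

lemma abs_absPt_add_unitVec_sub_le {h : ℝ} (hh : 0 ≤ h) (j : Fin d → ℤ) (k : Fin d) :
    |absPt h (j + unitVec k) - absPt h j| ≤ h := by
  have := abs_norm_sub_norm_le (latticePoint h (j + unitVec k)) (latticePoint h j)
  rwa [latticePoint_add_unitVec, add_sub_cancel_left, PiLp.norm_single,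
    Real.norm_of_nonneg hh, ← latticePoint_add_unitVec] at this

lemma abs_absPt_sub_unitVec_sub_le {h : ℝ} (hh : 0 ≤ h) (j : Fin d → ℤ) (k : Fin d) :
    |absPt h (j - unitVec k) - absPt h j| ≤ h := by
  have := abs_absPt_add_unitVec_sub_le hh (j - unitVec k) k
  rwa [sub_add_cancel, abs_sub_comm] at this

lemma abs_coord_le_div {h r : ℝ} (hh : 0 < h) {j : Fin d → ℤ} (hj : absPt h j ≤ r) (k : Fin d) :
    |(j k : ℝ)| ≤ r / h := by
  have hcoord := (abs_mul_coord_le_absPt h j k).trans hj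
  rwa [abs_mul, abs_of_pos hh, ← le_div_iff₀' hh] at hcoord

lemma finite_absPt_lt {h : ℝ} (hh : 0 < h) (r : ℝ) :
    {j : Fin d → ℤ | absPt h j < r}.Finite := by
  obtain ⟨m, hm⟩ := exists_nat_gt (r / h)
  refine (Set.finite_Icc (fun _ : Fin d => -(m : ℤ)) fun _ => (m : ℤ)).subset fun j hj => ?_
  have habs (k : Fin d) : |(j k : ℝ)| ≤ m := (abs_coord_le_div hh hj.out.le k).trans hm.le
  exact ⟨fun k => by exact_mod_cast (abs_le.1 (habs k)).1,
    fun k => by exact_mod_cast (abs_le.1 (habs k)).2⟩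

/-- The summand `|u_j|²` of `annulusMass`, extended by zero to the whole lattice. -/
noncomputable def annulusDensity (h R : ℝ) (u : (Fin d → ℤ) → ℝ) : (Fin d → ℤ) → ℝ :=
  {j | R - 2 < absPt h j ∧ absPt h j < R + 1}.indicator fun j => u j ^ 2

lemma annulusMass_eq_tsum_annulusDensity (h R : ℝ) (u : (Fin d → ℤ) → ℝ) :
    annulusMass h R u = h ^ d * ∑' j, annulusDensity h R u j := by
  simp only [annulusMass, annulusDensity, sq_abs, ← _root_.tsum_subtype]
  rfl

lemma annulusDensity_of_mem {h R : ℝ} {u : (Fin d → ℤ) → ℝ} {j : Fin d → ℤ}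
    (hlower : R - 2 < absPt h j) (hupper : absPt h j < R + 1) :
    annulusDensity h R u j = u j ^ 2 :=
  Set.indicator_of_mem (s := {j | R - 2 < absPt h j ∧ absPt h j < R + 1}) ⟨hlower, hupper⟩ _

lemma annulusDensity_nonneg (h R : ℝ) (u : (Fin d → ℤ) → ℝ) (j : Fin d → ℤ) :
    0 ≤ annulusDensity h R u j :=
  Set.indicator_nonneg (fun _ _ => sq_nonneg _) j

lemma summable_annulusDensity {h : ℝ} (hh : 0 < h) (R : ℝ) (u : (Fin d → ℤ) → ℝ) :
    Summable (annulusDensity h R u) :=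
  summable_of_hasFiniteSupport <| (finite_absPt_lt hh (R + 1)).subset
    (Set.support_indicator_subset.trans fun _ hj => hj.2)

lemma ballMass_le_tsum_sq {h r : ℝ} (hh : 0 ≤ h) {u v : (Fin d → ℤ) → ℝ}
    (hv : v.HasFiniteSupport) (huv : ∀ j, absPt h j < r → v j = u j) :
    ballMass h r u ≤ h ^ d * ∑' j, v j ^ 2 := by
  have hsum : Summable fun j => v j ^ 2 :=
    summable_of_forall_comp_add_eq_zero hv 0 fun j hj => by simp_all
  have hsub : ∑' j : {j : Fin d → ℤ // absPt h j < r}, |u j| ^ 2 =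
      ∑' j : {j : Fin d → ℤ | absPt h j < r}, v j ^ 2 :=
    tsum_congr fun j => by rw [sq_abs, huv j j.2]
  rw [ballMass, hsub]
  gcongr
  exact hsum.tsum_subtype_le _ _ fun _ => sq_nonneg _

lemma latticeLaplacian_mul_add_eq_laplacianCommutator {h : ℝ} (hh : h ≠ 0)
    {V u : (Fin d → ℤ) → ℝ} (χ : (Fin d → ℤ) → ℝ) {j : Fin d → ℤ}
    (hu : discreteLaplacian h u j + V j * u j = 0) :
    latticeLaplacian (fun j => χ j * u j) j + h ^ 2 * V j * (χ j * u j) =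
      laplacianCommutator χ u j := by
  rw [discreteLaplacian_eq_div] at hu
  field_simp at hu
  rw [laplacianCommutator]
  linear_combination χ j * hu

lemma laplacianCommutator_eq_zero_of_le_absPt {h r : ℝ} (hh : 0 ≤ h) {χ : (Fin d → ℤ) → ℝ}
    (hχ : ∀ j, r - h ≤ absPt h j → χ j = 0) (u : (Fin d → ℤ) → ℝ) {j : Fin d → ℤ}
    (hj : r ≤ absPt h j) : laplacianCommutator χ u j = 0 := by
  have hχj : χ j = 0 := hχ j (by linarith)
  refine laplacianCommutator_eq_zero (fun k => ?_) fun k => ?_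
  · rw [hχj, hχ _ (by linarith [(abs_le.1 (abs_absPt_add_unitVec_sub_le hh j k)).1])]
  · rw [hχj, hχ _ (by linarith [(abs_le.1 (abs_absPt_sub_unitVec_sub_le hh j k)).1])]

theorem ballMass_le_of_cutoff (i : Fin d) {h R Θ M K : ℝ} (hh : 0 < h) (hR : 0 < R)
    (hΘ : 0 ≤ Θ)
    (hM : h ^ 4 * (M ^ 2 + 1) ≤ 4 * Real.sinh (Θ / ((R + 1) / h)) * Real.sinh Θ ^ 2)
    {V u χ : (Fin d → ℤ) → ℝ} (hV : ∀ j, |V j| ≤ M)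
    (hu : ∀ j, discreteLaplacian h u j + V j * u j = 0)
    (hone : ∀ j, absPt h j < R - 1 → χ j = 1) (hzero : ∀ j, R + 1 - h ≤ absPt h j → χ j = 0)
    (hK : ∑' j, laplacianCommutator χ u j ^ 2 ≤ K * ∑' j, annulusDensity h R u j) :
    h ^ 4 * ballMass h (R - 1) u ≤
      Real.exp (10 * (Θ * ((R + 1) / h))) * (K * annulusMass h R u) := by
  have hfar {j : Fin d → ℤ} (hj : χ j * u j ≠ 0) : absPt h j < R + 1 - h := by
    by_contra! hle
    exact hj (by rw [hzero j hle, zero_mul])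
  have hfin : (fun j => χ j * u j).HasFiniteSupport :=
    (finite_absPt_lt hh (R + 1 - h)).subset fun j hj => hfar hj
  have hequation (j : Fin d → ℤ) := latticeLaplacian_mul_add_eq_laplacianCommutator hh.ne' χ (hu j)
  have hcarleman : h ^ 4 * ∑' j, (χ j * u j) ^ 2 ≤ Real.exp (10 * (Θ * ((R + 1) / h))) *
      ∑' j, laplacianCommutator χ u j ^ 2 := by
    simp only [← hequation]
    refine mul_tsum_sq_le_exp_mul i (by positivity) hΘ (by positivity) (m := h ^ 2 * M) ?_
      (fun j => ?_) hfin (fun j hj => abs_coord_le_div hh ?_ i)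
      (fun j hj => abs_coord_le_div hh ?_ i)
    · linear_combination hM
    · rw [abs_mul, abs_of_pos (by positivity)]
      gcongr
      exact hV j
    · linarith [hfar hj]
    · by_contra! hle
      exact hj ((hequation j).trans
        (laplacianCommutator_eq_zero_of_le_absPt hh.le hzero u hle.le))
  calc h ^ 4 * ballMass h (R - 1) u
      ≤ h ^ 4 * (h ^ d * ∑' j, (χ j * u j) ^ 2) := by
        gcongr
        exact ballMass_le_tsum_sq hh.le hfin fun j hj => by rw [hone j hj, one_mul]
    _ = h ^ d * (h ^ 4 * ∑' j, (χ j * u j) ^ 2) := mul_left_comm _ _ _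
    _ ≤ h ^ d * (Real.exp (10 * (Θ * ((R + 1) / h))) *
          (K * ∑' j, annulusDensity h R u j)) :=
        mul_le_mul_of_nonneg_left (hcarleman.trans (by gcongr)) (by positivity)
    _ = _ := by rw [annulusMass_eq_tsum_annulusDensity]; ring

end Geometry

section SharpCutoff

lemma tsum_sq_laplacianCommutator_le_of_forall_edge {ι : Type*} [DecidableEq ι] [Fintype ι]
    {χ u b : (ι → ℤ) → ℝ} (hb : Summable b)
    (hplus : ∀ j k, ((χ (j + unitVec k) - χ j) * u (j + unitVec k)) ^ 2 ≤ b (j + unitVec k))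
    (hminus : ∀ j k, ((χ (j - unitVec k) - χ j) * u (j - unitVec k)) ^ 2 ≤ b (j - unitVec k)) :
    ∑' j, laplacianCommutator χ u j ^ 2 ≤ 4 * Fintype.card ι ^ 2 * ∑' j, b j := by
  have hpointwise (j : ι → ℤ) : laplacianCommutator χ u j ^ 2 ≤
      Fintype.card ι * ∑ k, 2 * (b (j + unitVec k) + b (j - unitVec k)) := by
    rw [laplacianCommutator_eq_sum]
    refine sq_sum_le_card_mul_sum_sq.trans ?_
    rw [card_univ]
    gcongr with k
    linarith [add_sq_le (a := (χ (j + unitVec k) - χ j) * u (j + unitVec k))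
      (b := (χ (j - unitVec k) - χ j) * u (j - unitVec k)), hplus j k, hminus j k]
  have hshift (k : ι) : HasSum (fun j => 2 * (b (j + unitVec k) + b (j - unitVec k)))
      (2 * (∑' j, b j + ∑' j, b j)) :=
    (((Equiv.addRight (unitVec k)).hasSum_iff.2 hb.hasSum).add
      ((Equiv.subRight (unitVec k)).hasSum_iff.2 hb.hasSum)).mul_left 2
  have hsum := (hasSum_sum fun k (_ : k ∈ univ) => hshift k).mul_left (Fintype.card ι : ℝ)
  calc ∑' j, laplacianCommutator χ u j ^ 2
      ≤ Fintype.card ι * ∑ _k : ι, 2 * (∑' j, b j + ∑' j, b j) :=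
        hasSum_le hpointwise
          (hsum.summable.of_nonneg_of_le (fun _ => sq_nonneg _) hpointwise).hasSum hsum
    _ = 4 * Fintype.card ι ^ 2 * ∑' j, b j := by
        rw [sum_const, card_univ, nsmul_eq_mul]; ring

variable {d : ℕ}

/-- The indicator function of the ball `|hj| < R - 1/2`, whose boundary layer of width `h < 3/2`
stays inside the annulus. -/
noncomputable def sharpCutoff (h R : ℝ) : (Fin d → ℤ) → ℝ :=
  {j | absPt h j < R - 1 / 2}.indicator 1

lemma sharpCutoff_of_lt {h R : ℝ} {j : Fin d → ℤ} (hj : absPt h j < R - 1 / 2) :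
    sharpCutoff h R j = 1 :=
  Set.indicator_of_mem (s := {j | absPt h j < R - 1 / 2}) hj 1

lemma sharpCutoff_of_le {h R : ℝ} {j : Fin d → ℤ} (hj : R - 1 / 2 ≤ absPt h j) :
    sharpCutoff h R j = 0 :=
  Set.indicator_of_notMem (s := {j | absPt h j < R - 1 / 2}) hj.not_gt 1

lemma sq_sharpCutoff_sub_mul_le_annulusDensity {h R : ℝ} (hh : h < 3 / 2)
    (u : (Fin d → ℤ) → ℝ) {j l : Fin d → ℤ} (hjl : |absPt h l - absPt h j| ≤ h) :
    ((sharpCutoff h R l - sharpCutoff h R j) * u l) ^ 2 ≤ annulusDensity h R u l := by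
  obtain ⟨hlower, hupper⟩ := abs_le.1 hjl
  rcases lt_or_ge (absPt h j) (R - 1 / 2) with hj | hj <;>
    rcases lt_or_ge (absPt h l) (R - 1 / 2) with hl | hl
  · simpa [sharpCutoff_of_lt hj, sharpCutoff_of_lt hl] using annulusDensity_nonneg h R u l
  · rw [annulusDensity_of_mem (by linarith) (by linarith)]
    simp [sharpCutoff_of_lt hj, sharpCutoff_of_le hl]
  · rw [annulusDensity_of_mem (by linarith) (by linarith)]
    simp [sharpCutoff_of_le hj, sharpCutoff_of_lt hl]
  · simpa [sharpCutoff_of_le hj, sharpCutoff_of_le hl] using annulusDensity_nonneg h R u l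

theorem ballMass_le_of_lt_three_halves (i : Fin d) {h R Θ M : ℝ} (hh : 0 < h) (hh' : h < 3 / 2)
    (hR : 0 < R) (hΘ : 0 ≤ Θ)
    (hM : h ^ 4 * (M ^ 2 + 1) ≤ 4 * Real.sinh (Θ / ((R + 1) / h)) * Real.sinh Θ ^ 2)
    {V u : (Fin d → ℤ) → ℝ} (hV : ∀ j, |V j| ≤ M)
    (hu : ∀ j, discreteLaplacian h u j + V j * u j = 0) :
    h ^ 4 * ballMass h (R - 1) u ≤
      Real.exp (10 * (Θ * ((R + 1) / h))) * (4 * d ^ 2 * annulusMass h R u) := by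
  refine ballMass_le_of_cutoff i hh hR hΘ hM hV hu (χ := sharpCutoff h R)
    (fun j hj => sharpCutoff_of_lt (by linarith)) (fun j hj => sharpCutoff_of_le (by linarith)) ?_
  simpa only [Fintype.card_fin] using
    tsum_sq_laplacianCommutator_le_of_forall_edge (χ := sharpCutoff h R)
      (summable_annulusDensity hh R u)
      (fun j k => sq_sharpCutoff_sub_mul_le_annulusDensity hh' u
        (abs_absPt_add_unitVec_sub_le hh.le j k))
      (fun j k => sq_sharpCutoff_sub_mul_le_annulusDensity hh' u
        (abs_absPt_sub_unitVec_sub_le hh.le j k))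

end SharpCutoff

section SmoothTransition

lemma exists_lipschitzWith_smoothTransition :
    ∃ K, LipschitzWith K Real.smoothTransition ∧ LipschitzWith K (deriv Real.smoothTransition) := by
  have hderiv : ContDiff ℝ 1 (deriv Real.smoothTransition) :=
    (contDiff_succ_iff_deriv.1 (Real.smoothTransition.contDiff (n := 1 + 1))).2.2
  have hsupport : HasCompactSupport (deriv Real.smoothTransition) := by
    refine HasCompactSupport.intro (isCompact_Icc (a := (0 : ℝ)) (b := 1)) fun x hx => ?_
    rw [Set.mem_Icc, not_and_or, not_le, not_le] at hx
    rcases hx with hx | hx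
    · have hzero : Real.smoothTransition =ᶠ[nhds x] fun _ => 0 :=
        Filter.eventuallyEq_of_mem (Iio_mem_nhds hx) fun _ hy =>
          Real.smoothTransition.zero_of_nonpos (Set.mem_Iio.1 hy).le
      rw [hzero.deriv_eq, deriv_const]
    · have hone : Real.smoothTransition =ᶠ[nhds x] fun _ => 1 :=
        Filter.eventuallyEq_of_mem (Ioi_mem_nhds hx) fun _ hy =>
          Real.smoothTransition.one_of_one_le (Set.mem_Ioi.1 hy).le
      rw [hone.deriv_eq, deriv_const]
  obtain ⟨B, hB⟩ := hderiv.continuous.bounded_above_of_compact_support hsupport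
  obtain ⟨L, hL⟩ := hderiv.lipschitzWith_of_hasCompactSupport hsupport one_ne_zero
  have hlipschitz : LipschitzWith B.toNNReal Real.smoothTransition :=
    lipschitzWith_of_nnnorm_deriv_le Real.smoothTransition.contDiff.differentiable_one
      fun x => NNReal.le_toNNReal_of_coe_le (hB x)
  exact ⟨max B.toNNReal L, hlipschitz.weaken (le_max_left _ _), hL.weaken (le_max_right _ _)⟩

lemma abs_add_sub_mul_deriv_le {f : ℝ → ℝ} {K : NNReal} (hf : Differentiable ℝ f)
    (hK : LipschitzWith K (deriv f)) (t s : ℝ) :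
    |f (t + s) - f t - s * deriv f t| ≤ K * s ^ 2 := by
  have hderiv (x : ℝ) : HasDerivAt (fun x => f x - x * deriv f t) (deriv f x - deriv f t) x :=
    (hf x).hasDerivAt.fun_sub (hasDerivAt_mul_const _)
  have hbound : ∀ x ∈ Set.uIcc t (t + s), ‖deriv f x - deriv f t‖ ≤ K * |s| := fun x hx =>
    (hK.norm_sub_le x t).trans <| by
      gcongr
      simpa using Set.abs_sub_left_of_mem_uIcc hx
  calc |f (t + s) - f t - s * deriv f t|
      = ‖f (t + s) - (t + s) * deriv f t - (f t - t * deriv f t)‖ := by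
        rw [Real.norm_eq_abs]; congr 1; ring
    _ ≤ K * |s| * ‖t + s - t‖ :=
        (convex_uIcc t (t + s)).norm_image_sub_le_of_norm_hasDerivWithin_le
          (fun x _ => (hderiv x).hasDerivWithinAt) hbound Set.left_mem_uIcc Set.right_mem_uIcc
    _ = K * s ^ 2 := by
        rw [add_sub_cancel_left, Real.norm_eq_abs, mul_assoc, abs_mul_abs_self, sq]

lemma abs_add_add_sub_sub_two_mul_le {f : ℝ → ℝ} {K L : NNReal} (hf : Differentiable ℝ f)
    (hK : LipschitzWith K f) (hL : LipschitzWith L (deriv f)) (t a b : ℝ) :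
    |f (t + a) + f (t - b) - 2 * f t| ≤ K * |a - b| + L * (a ^ 2 + b ^ 2) := by
  have hslope : |(a - b) * deriv f t| ≤ K * |a - b| := by
    rw [abs_mul, mul_comm]
    gcongr
    exact norm_deriv_le_of_lipschitz hK
  have hplus := abs_add_sub_mul_deriv_le hf hL t a
  have hminus := abs_add_sub_mul_deriv_le hf hL t (-b)
  rw [← sub_eq_add_neg, neg_sq] at hminus
  rw [abs_le] at *
  constructor <;> linarith

end SmoothTransition

section DirichletForm

variable {ι : Type*} [DecidableEq ι]

lemma hasFiniteSupport_add_unitVec_sub {g : (ι → ℤ) → ℝ} (hg : g.HasFiniteSupport) (k : ι) :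
    (fun j => g (j + unitVec k) - g j).HasFiniteSupport :=
  (hg.fun_comp_of_injective (add_left_injective _)).fun_sub hg

variable [Fintype ι]

/-- The unscaled Dirichlet form: the sum of the squared differences of `g` over all lattice
edges. -/
noncomputable def dirichletForm (g : (ι → ℤ) → ℝ) : ℝ :=
  ∑ k, ∑' j, (g (j + unitVec k) - g j) ^ 2

lemma hasSum_sq_sub_add_sq_sub {g : (ι → ℤ) → ℝ} (hg : g.HasFiniteSupport) :
    HasSum (fun j => ∑ k, ((g (j + unitVec k) - g j) ^ 2 + (g (j - unitVec k) - g j) ^ 2))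
      (2 * dirichletForm g) := by
  rw [dirichletForm, mul_sum]
  refine hasSum_sum fun k _ => ?_
  have hforward : Summable fun j => (g (j + unitVec k) - g j) ^ 2 :=
    summable_of_forall_comp_add_eq_zero (hasFiniteSupport_add_unitVec_sub hg k) 0
      fun j hj => by simp_all
  rw [two_mul]
  refine hforward.hasSum.add (((Equiv.subRight (unitVec k)).hasSum_iff.2 hforward.hasSum).congr_fun
    fun j => ?_)
  simp only [comp_apply, Equiv.subRight_apply, sub_add_cancel]
  ring

lemma sq_laplacianCommutator_le {χ u : (ι → ℤ) → ℝ} {j : ι → ℤ} {δ ε : ℝ}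
    (hplus : ∀ k, |χ (j + unitVec k) - χ j| ≤ δ) (hminus : ∀ k, |χ (j - unitVec k) - χ j| ≤ δ)
    (hsecond : ∀ k, |χ (j + unitVec k) + χ (j - unitVec k) - 2 * χ j| ≤ ε) :
    laplacianCommutator χ u j ^ 2 ≤ 3 * Fintype.card ι *
      (δ ^ 2 * ∑ k, ((u (j + unitVec k) - u j) ^ 2 + (u (j - unitVec k) - u j) ^ 2) +
        Fintype.card ι * ε ^ 2 * u j ^ 2) := by
  have hsq {x c : ℝ} (hx : |x| ≤ c) (y : ℝ) : (x * y) ^ 2 ≤ c ^ 2 * y ^ 2 := by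
    rw [mul_pow, ← sq_abs x]
    gcongr
  have hterm (k : ι) : ((χ (j + unitVec k) - χ j) * u (j + unitVec k) +
      (χ (j - unitVec k) - χ j) * u (j - unitVec k)) ^ 2 ≤
      3 * (δ ^ 2 * ((u (j + unitVec k) - u j) ^ 2 + (u (j - unitVec k) - u j) ^ 2) +
        ε ^ 2 * u j ^ 2) := by
    set p := (χ (j + unitVec k) - χ j) * (u (j + unitVec k) - u j)
    set q := (χ (j - unitVec k) - χ j) * (u (j - unitVec k) - u j)
    set r := (χ (j + unitVec k) + χ (j - unitVec k) - 2 * χ j) * u j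
    calc _ = (p + q + r) ^ 2 := by ring
      _ ≤ 3 * (p ^ 2 + q ^ 2 + r ^ 2) := by
          linarith [sq_nonneg (p - q), sq_nonneg (p - r), sq_nonneg (q - r)]
      _ ≤ _ := by
          linarith [hsq (hplus k) (u (j + unitVec k) - u j),
            hsq (hminus k) (u (j - unitVec k) - u j), hsq (hsecond k) (u j)]
  rw [laplacianCommutator_eq_sum]
  refine sq_sum_le_card_mul_sum_sq.trans ?_
  rw [card_univ, mul_comm 3, mul_assoc]
  gcongr
  refine (sum_le_sum fun k _ => hterm k).trans_eq ?_
  rw [← mul_sum, sum_add_distrib, ← mul_sum, sum_const, card_univ, nsmul_eq_mul]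
  ring

theorem tsum_sq_laplacianCommutator_le_dirichletForm {χ u g : (ι → ℤ) → ℝ}
    (hg : g.HasFiniteSupport) {δ ε : ℝ}
    (hlocal : ∀ j, laplacianCommutator χ u j = 0 ∨
      laplacianCommutator χ u j = laplacianCommutator χ g j ∧
      ∀ k, |χ (j + unitVec k) - χ j| ≤ δ ∧ |χ (j - unitVec k) - χ j| ≤ δ ∧
        |χ (j + unitVec k) + χ (j - unitVec k) - 2 * χ j| ≤ ε) :
    ∑' j, laplacianCommutator χ u j ^ 2 ≤ 3 * Fintype.card ι *
      (δ ^ 2 * (2 * dirichletForm g) + Fintype.card ι * ε ^ 2 * ∑' j, g j ^ 2) := by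
  have hg_sq : Summable fun j => g j ^ 2 :=
    summable_of_forall_comp_add_eq_zero hg 0 fun j hj => by simp_all
  have hsum := (((hasSum_sq_sub_add_sq_sub hg).mul_left (δ ^ 2)).add
    (hg_sq.hasSum.mul_left (Fintype.card ι * ε ^ 2))).mul_left (3 * (Fintype.card ι : ℝ))
  have hpointwise (j : ι → ℤ) : laplacianCommutator χ u j ^ 2 ≤ 3 * Fintype.card ι *
      (δ ^ 2 * ∑ k, ((g (j + unitVec k) - g j) ^ 2 + (g (j - unitVec k) - g j) ^ 2) +
        Fintype.card ι * ε ^ 2 * g j ^ 2) := by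
    rcases hlocal j with hzero | ⟨hcongr, hχ⟩
    · rw [hzero, zero_pow two_ne_zero]
      positivity
    · rw [hcongr]
      exact sq_laplacianCommutator_le (fun k => (hχ k).1) (fun k => (hχ k).2.1)
        fun k => (hχ k).2.2
  exact hasSum_le hpointwise
    (hsum.summable.of_nonneg_of_le (fun _ => sq_nonneg _) hpointwise).hasSum hsum

/-- The IMS localisation formula, a discrete form of
`∫ |∇(ζu)|² = ∫ |∇ζ|² u² - ∫ ζ² u Δu`. -/
lemma dirichletForm_mul {ζ : (ι → ℤ) → ℝ} (hζ : ζ.HasFiniteSupport) (u : (ι → ℤ) → ℝ) :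
    dirichletForm (fun j => ζ j * u j) =
      ∑ k, ∑' j, (ζ (j + unitVec k) - ζ j) ^ 2 * (u j * u (j + unitVec k)) -
        ∑' j, ζ j ^ 2 * (u j * latticeLaplacian u j) := by
  have hζ_summable (F : (ι → ℤ) → ℝ) : Summable fun j => ζ j ^ 2 * F j :=
    summable_of_forall_comp_add_eq_zero hζ 0 fun j hj => by simp_all
  have hedge (k : ι) : Summable fun j =>
      (ζ (j + unitVec k) - ζ j) ^ 2 * (u j * u (j + unitVec k)) :=
    summable_of_forall_comp_add_eq_zero (hasFiniteSupport_add_unitVec_sub hζ k) 0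
      fun j hj => by simp_all
  have hlaplacian : ∑' j, ζ j ^ 2 * (u j * latticeLaplacian u j) =
      ∑ k, ∑' j, ζ j ^ 2 * (u j * (u (j + unitVec k) - 2 * u j + u (j - unitVec k))) := by
    simp only [latticeLaplacian, mul_sum]
    exact Summable.tsum_finsetSum fun k _ => hζ_summable _
  rw [hlaplacian, ← sum_sub_distrib, dirichletForm]
  refine sum_congr rfl fun k _ => HasSum.tsum_eq ?_
  have htelescope := hasSum_sub_comp_add (hζ_summable fun j => u j * (u j - u (j - unitVec k)))
    (unitVec k)
  have hsum := ((hedge k).hasSum.sub htelescope).sub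
    (hζ_summable fun j => u j * (u (j + unitVec k) - 2 * u j + u (j - unitVec k))).hasSum
  rw [sub_zero] at hsum
  refine hsum.congr_fun fun j => ?_
  simp only [add_sub_cancel_right]
  ring

theorem dirichletForm_mul_le {ζ u b : (ι → ℤ) → ℝ} (hζ : ζ.HasFiniteSupport) (hb : Summable b)
    {L P : ℝ}
    (hedge : ∀ j k, (ζ (j + unitVec k) - ζ j) ^ 2 * (u j * u (j + unitVec k)) ≤
      L * ((b j + b (j + unitVec k)) / 2))
    (hlaplacian : ∀ j, -(ζ j ^ 2 * (u j * latticeLaplacian u j)) ≤ P * b j) :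
    dirichletForm (fun j => ζ j * u j) ≤ (Fintype.card ι * L + P) * ∑' j, b j := by
  have hedge_sum (k : ι) :
      ∑' j, (ζ (j + unitVec k) - ζ j) ^ 2 * (u j * u (j + unitVec k)) ≤ L * ∑' j, b j := by
    have hshift := ((hb.hasSum.add ((Equiv.addRight (unitVec k)).hasSum_iff.2 hb.hasSum)).div_const
      2).mul_left L
    rw [add_self_div_two] at hshift
    exact hasSum_le (hedge · k) (summable_of_forall_comp_add_eq_zero
      (hasFiniteSupport_add_unitVec_sub hζ k) 0 fun j hj => by simp_all).hasSum hshift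
  have hlaplacian_sum : -∑' j, ζ j ^ 2 * (u j * latticeLaplacian u j) ≤ P * ∑' j, b j :=
    hasSum_le hlaplacian (summable_of_forall_comp_add_eq_zero hζ 0
      fun j hj => by simp_all).hasSum.neg (hb.hasSum.mul_left P)
  have hedges := sum_le_card_nsmul univ _ _ fun k _ => hedge_sum k
  rw [card_univ, nsmul_eq_mul] at hedges
  rw [dirichletForm_mul hζ]
  linarith

end DirichletForm

section SmoothCutoff

variable {d : ℕ} {K : NNReal}

/-- A smooth radial cutoff, equal to `1` for `|hj| ≤ R - 1` and to `0` for `|hj| ≥ R`. It is a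
function of `|hj|²` because the second differences of `|hj|²` are constant. -/
noncomputable def radialCutoff (h R : ℝ) (j : Fin d → ℤ) : ℝ :=
  Real.smoothTransition ((R ^ 2 - absPt h j ^ 2) / R)

lemma radialCutoff_of_le_sub_one {h R : ℝ} (hR : 1 ≤ R) {j : Fin d → ℤ}
    (hj : absPt h j ≤ R - 1) : radialCutoff h R j = 1 := by
  refine Real.smoothTransition.one_of_one_le ?_
  rw [le_div_iff₀ (by linarith)]
  nlinarith [absPt_nonneg h j]

lemma radialCutoff_of_le {h R : ℝ} (hR : 0 ≤ R) {j : Fin d → ℤ} (hj : R ≤ absPt h j) :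
    radialCutoff h R j = 0 :=
  Real.smoothTransition.zero_of_nonpos <|
    div_nonpos_of_nonpos_of_nonneg (sub_nonpos.2 (by gcongr)) hR

lemma laplacianCommutator_radialCutoff_eq_zero {h R : ℝ} (hh : 0 ≤ h) (hR : 1 ≤ R)
    (u : (Fin d → ℤ) → ℝ) {j : Fin d → ℤ} (hj : 1 / 2 + h ≤ |absPt h j - (R - 1 / 2)|) :
    laplacianCommutator (radialCutoff h R) u j = 0 := by
  have heq {l : Fin d → ℤ} (hl : |absPt h l - absPt h j| ≤ h) :
      radialCutoff h R l = radialCutoff h R j := by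
    obtain ⟨hlower, hupper⟩ := abs_le.1 hl
    rcases le_abs.1 hj with houter | hinner
    · rw [radialCutoff_of_le (by linarith) (by linarith),
        radialCutoff_of_le (by linarith) (by linarith)]
    · rw [radialCutoff_of_le_sub_one hR (by linarith), radialCutoff_of_le_sub_one hR (by linarith)]
  exact laplacianCommutator_eq_zero (fun k => heq (abs_absPt_add_unitVec_sub_le hh j k))
    fun k => heq (abs_absPt_sub_unitVec_sub_le hh j k)

lemma radialCutoff_add_unitVec (h R : ℝ) (j : Fin d → ℤ) (k : Fin d) :
    radialCutoff h R (j + unitVec k) = Real.smoothTransition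
      ((R ^ 2 - absPt h j ^ 2) / R + -(2 * (h * (h * j k)) + h ^ 2) / R) := by
  rw [radialCutoff, absPt_add_unitVec_sq]
  congr 1
  ring

lemma radialCutoff_sub_unitVec (h R : ℝ) (j : Fin d → ℤ) (k : Fin d) :
    radialCutoff h R (j - unitVec k) = Real.smoothTransition
      ((R ^ 2 - absPt h j ^ 2) / R - -(2 * (h * (h * j k)) - h ^ 2) / R) := by
  rw [radialCutoff, absPt_sub_unitVec_sq]
  congr 1
  ring

lemma abs_neg_two_mul_add_div_le {h R x s : ℝ} (hh : 0 ≤ h) (hh' : h ≤ 1) (hR : 3 ≤ R)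
    (hx : |x| ≤ R + 1) (hs : |s| ≤ h ^ 2) : |-(2 * (h * x) + s) / R| ≤ 3 * h := by
  have hR' : 0 < R := by linarith
  rw [abs_div, abs_neg, abs_of_pos hR', div_le_iff₀ hR']
  calc |2 * (h * x) + s| ≤ |2 * (h * x)| + |s| := abs_add_le _ _
    _ ≤ 2 * (h * (R + 1)) + h ^ 2 := by
        rw [abs_mul, abs_mul, abs_of_pos two_pos, abs_of_nonneg hh]
        gcongr
    _ ≤ 3 * h * R := by nlinarith

lemma abs_radialCutoff_differences_le (hK : LipschitzWith K Real.smoothTransition)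
    (hK' : LipschitzWith K (deriv Real.smoothTransition)) {h R : ℝ} (hh : 0 ≤ h) (hh' : h ≤ 1)
    (hR : 3 ≤ R) {j : Fin d → ℤ} (hj : absPt h j ≤ R + 1) (k : Fin d) :
    |radialCutoff h R (j + unitVec k) - radialCutoff h R j| ≤ 3 * K * h ∧
    |radialCutoff h R (j - unitVec k) - radialCutoff h R j| ≤ 3 * K * h ∧
    |radialCutoff h R (j + unitVec k) + radialCutoff h R (j - unitVec k) -
      2 * radialCutoff h R j| ≤ 19 * K * h ^ 2 := by
  have hx := (abs_mul_coord_le_absPt h j k).trans hj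
  have ha := abs_neg_two_mul_add_div_le hh hh' hR hx (s := h ^ 2) (by rw [abs_sq])
  have hb := abs_neg_two_mul_add_div_le hh hh' hR hx (s := -h ^ 2) (by rw [abs_neg, abs_sq])
  rw [← sub_eq_add_neg] at hb
  rw [radialCutoff_add_unitVec, radialCutoff_sub_unitVec, radialCutoff]
  set t := (R ^ 2 - absPt h j ^ 2) / R
  set a := -(2 * (h * (h * j k)) + h ^ 2) / R with ha_def
  set b := -(2 * (h * (h * j k)) - h ^ 2) / R with hb_def
  have hab : |a - b| ≤ h ^ 2 := by
    have hR' : 0 < R := by linarith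
    rw [ha_def, hb_def, ← sub_div, abs_div, abs_of_pos hR', div_le_iff₀ hR', abs_le]
    constructor <;> nlinarith [sq_nonneg h]
  refine ⟨?_, ?_, ?_⟩
  · calc _ ≤ K * |t + a - t| := hK.norm_sub_le _ _
      _ ≤ K * (3 * h) := by rw [add_sub_cancel_left]; gcongr
      _ = _ := by ring
  · calc _ ≤ K * |t - b - t| := hK.norm_sub_le _ _
      _ ≤ K * (3 * h) := by rw [sub_sub_cancel_left, abs_neg]; gcongr
      _ = _ := by ring
  · calc _ ≤ K * |a - b| + K * (|a| ^ 2 + |b| ^ 2) := by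
          rw [sq_abs, sq_abs]
          exact abs_add_add_sub_sub_two_mul_le
            Real.smoothTransition.contDiff.differentiable_one hK hK' t a b
      _ ≤ K * h ^ 2 + K * ((3 * h) ^ 2 + (3 * h) ^ 2) := by gcongr
      _ = _ := by ring

/-- A smooth cutoff to the annulus, equal to `1` where `||hj| - (R - 1/2)| ≤ 1` and to `0` where
`||hj| - (R - 1/2)| ≥ 4/3`. -/
noncomputable def annularCutoff (h R : ℝ) (j : Fin d → ℤ) : ℝ :=
  Real.smoothTransition (4 - 3 * |absPt h j - (R - 1 / 2)|)

lemma annularCutoff_of_le {h R : ℝ} {j : Fin d → ℤ} (hj : |absPt h j - (R - 1 / 2)| ≤ 1) :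
    annularCutoff h R j = 1 :=
  Real.smoothTransition.one_of_one_le (by linarith)

lemma annularCutoff_of_ge {h R : ℝ} {j : Fin d → ℤ} (hj : 4 / 3 ≤ |absPt h j - (R - 1 / 2)|) :
    annularCutoff h R j = 0 :=
  Real.smoothTransition.zero_of_nonpos (by linarith)

lemma annularCutoff_sq_le_one (h R : ℝ) (j : Fin d → ℤ) : annularCutoff h R j ^ 2 ≤ 1 :=
  pow_le_one₀ (Real.smoothTransition.nonneg _) (Real.smoothTransition.le_one _)

lemma hasFiniteSupport_annularCutoff {h : ℝ} (hh : 0 < h) (R : ℝ) :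
    (annularCutoff (d := d) h R).HasFiniteSupport :=
  (finite_absPt_lt hh (R + 1)).subset fun j hj => lt_of_not_ge fun (hfar : R + 1 ≤ absPt h j) =>
    hj (annularCutoff_of_ge (le_abs.2 (.inl (by linarith))))

lemma abs_annularCutoff_sub_le (hK : LipschitzWith K Real.smoothTransition) (h R : ℝ)
    (j l : Fin d → ℤ) :
    |annularCutoff h R l - annularCutoff h R j| ≤ 3 * K * |absPt h l - absPt h j| := by
  have hreverse : |(|absPt h l - (R - 1 / 2)| - |absPt h j - (R - 1 / 2)|)| ≤
      |absPt h l - absPt h j| := by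
    simpa using abs_abs_sub_abs_le_abs_sub (absPt h l - (R - 1 / 2)) (absPt h j - (R - 1 / 2))
  calc |annularCutoff h R l - annularCutoff h R j|
      ≤ K * |4 - 3 * |absPt h l - (R - 1 / 2)| - (4 - 3 * |absPt h j - (R - 1 / 2)|)| :=
        hK.norm_sub_le _ _
    _ = 3 * K * |(|absPt h l - (R - 1 / 2)| - |absPt h j - (R - 1 / 2)|)| := by
        rw [sub_sub_sub_cancel_left, ← mul_sub, abs_mul, abs_of_pos three_pos, abs_sub_comm]
        ring
    _ ≤ 3 * K * |absPt h l - absPt h j| := by gcongr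

lemma annulusDensity_of_abs_sub_lt {h R : ℝ} {u : (Fin d → ℤ) → ℝ} {j : Fin d → ℤ}
    (hj : |absPt h j - (R - 1 / 2)| < 3 / 2) : annulusDensity h R u j = u j ^ 2 :=
  annulusDensity_of_mem (by linarith [(abs_lt.1 hj).1]) (by linarith [(abs_lt.1 hj).2])

lemma sq_annularCutoff_mul_le (h R : ℝ) (u : (Fin d → ℤ) → ℝ) (j : Fin d → ℤ) :
    (annularCutoff h R j * u j) ^ 2 ≤ annulusDensity h R u j := by
  rcases lt_or_ge |absPt h j - (R - 1 / 2)| (4 / 3) with hj | hj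
  · rw [annulusDensity_of_abs_sub_lt (by linarith), mul_pow]
    exact mul_le_of_le_one_left (sq_nonneg _) (annularCutoff_sq_le_one h R j)
  · simpa [annularCutoff_of_ge hj] using annulusDensity_nonneg h R u j

lemma sq_annularCutoff_sub_mul_le (hK : LipschitzWith K Real.smoothTransition) {h R : ℝ}
    (hh : h ≤ 1 / 10) (u : (Fin d → ℤ) → ℝ) {j l : Fin d → ℤ}
    (hjl : |absPt h l - absPt h j| ≤ h) :
    (annularCutoff h R l - annularCutoff h R j) ^ 2 * (u j * u l) ≤
      (3 * K * h) ^ 2 * ((annulusDensity h R u j + annulusDensity h R u l) / 2) := by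
  have hb := annulusDensity_nonneg h R u
  have hnear {i i' : Fin d → ℤ} (hi : |absPt h i' - absPt h i| ≤ h)
      (hi' : |absPt h i - (R - 1 / 2)| < 4 / 3) : |absPt h i' - (R - 1 / 2)| < 3 / 2 := by
    linarith [abs_sub_le (absPt h i') (absPt h i) (R - 1 / 2)]
  have hlipschitz : |annularCutoff h R l - annularCutoff h R j| ^ 2 ≤ (3 * K * h) ^ 2 := by
    gcongr
    exact (abs_annularCutoff_sub_le hK h R j l).trans (by gcongr)
  rw [sq_abs] at hlipschitz
  by_cases hboth : |absPt h j - (R - 1 / 2)| < 3 / 2 ∧ |absPt h l - (R - 1 / 2)| < 3 / 2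
  · rw [annulusDensity_of_abs_sub_lt hboth.1, annulusDensity_of_abs_sub_lt hboth.2]
    calc _ ≤ (annularCutoff h R l - annularCutoff h R j) ^ 2 * ((u j ^ 2 + u l ^ 2) / 2) := by
          gcongr
          linarith [two_mul_le_add_sq (u j) (u l)]
      _ ≤ _ := by gcongr
  · have hj : 4 / 3 ≤ |absPt h j - (R - 1 / 2)| := by
      by_contra! hj
      exact hboth ⟨by linarith, hnear hjl hj⟩
    have hl : 4 / 3 ≤ |absPt h l - (R - 1 / 2)| := by
      by_contra! hl
      exact hboth ⟨hnear (by rwa [abs_sub_comm]) hl, by linarith⟩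
    rw [annularCutoff_of_ge hj, annularCutoff_of_ge hl, sub_zero, zero_pow two_ne_zero, zero_mul]
    have := add_nonneg (hb j) (hb l)
    positivity

theorem dirichletForm_annularCutoff_mul_le (hK : LipschitzWith K Real.smoothTransition)
    {h R M : ℝ} (hh : 0 < h) (hh' : h ≤ 1 / 10) {V u : (Fin d → ℤ) → ℝ} (hV : ∀ j, |V j| ≤ M)
    (hu : ∀ j, discreteLaplacian h u j + V j * u j = 0) :
    dirichletForm (fun j => annularCutoff h R j * u j) ≤
      (d * (3 * K * h) ^ 2 + h ^ 2 * M) * ∑' j, annulusDensity h R u j := by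
  have hlaplacian (j : Fin d → ℤ) :
      -(annularCutoff h R j ^ 2 * (u j * latticeLaplacian u j)) ≤
        h ^ 2 * M * annulusDensity h R u j := by
    have hequation : latticeLaplacian u j = -(h ^ 2 * V j * u j) := by
      have := hu j
      rw [discreteLaplacian_eq_div] at this
      field_simp at this
      linear_combination this
    calc _ = h ^ 2 * V j * (annularCutoff h R j * u j) ^ 2 := by rw [hequation]; ring
      _ ≤ h ^ 2 * M * annulusDensity h R u j := by
          have hM : 0 ≤ M := (abs_nonneg _).trans (hV j)
          gcongr
          · exact (abs_le.1 (hV j)).2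
          · exact sq_annularCutoff_mul_le h R u j
  simpa only [Fintype.card_fin] using dirichletForm_mul_le (hasFiniteSupport_annularCutoff hh R)
    (summable_annulusDensity hh R u)
    (fun j k => sq_annularCutoff_sub_mul_le hK hh' u (abs_absPt_add_unitVec_sub_le hh.le j k))
    hlaplacian

theorem tsum_sq_laplacianCommutator_radialCutoff_le
    (hK : LipschitzWith K Real.smoothTransition)
    (hK' : LipschitzWith K (deriv Real.smoothTransition)) {h R M : ℝ} (hh : 0 < h)
    (hh' : h ≤ 1 / 10) (hR : 3 ≤ R) {V u : (Fin d → ℤ) → ℝ} (hV : ∀ j, |V j| ≤ M)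
    (hu : ∀ j, discreteLaplacian h u j + V j * u j = 0) :
    ∑' j, laplacianCommutator (radialCutoff h R) u j ^ 2 ≤
      h ^ 4 * (3 * d * (18 * K ^ 2 * (9 * d * K ^ 2 + M) + 361 * d * K ^ 2)) *
        ∑' j, annulusDensity h R u j := by
  set g : (Fin d → ℤ) → ℝ := fun j => annularCutoff h R j * u j
  have hg_fin : g.HasFiniteSupport := (hasFiniteSupport_annularCutoff hh R).fun_mul_left u
  have hg_sq : ∑' j, g j ^ 2 ≤ ∑' j, annulusDensity h R u j :=
    (summable_of_forall_comp_add_eq_zero hg_fin 0 fun j hj => by simp_all).tsum_le_tsum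
      (sq_annularCutoff_mul_le h R u) (summable_annulusDensity hh R u)
  have hlocal (j : Fin d → ℤ) : laplacianCommutator (radialCutoff h R) u j = 0 ∨
      laplacianCommutator (radialCutoff h R) u j = laplacianCommutator (radialCutoff h R) g j ∧
      ∀ k, |radialCutoff h R (j + unitVec k) - radialCutoff h R j| ≤ 3 * K * h ∧
        |radialCutoff h R (j - unitVec k) - radialCutoff h R j| ≤ 3 * K * h ∧
        |radialCutoff h R (j + unitVec k) + radialCutoff h R (j - unitVec k) -
          2 * radialCutoff h R j| ≤ 19 * K * h ^ 2 := by
    rcases le_or_gt (1 / 2 + h) |absPt h j - (R - 1 / 2)| with hfar | hnear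
    · exact .inl (laplacianCommutator_radialCutoff_eq_zero hh.le (by linarith) u hfar)
    · have hneighbour {l : Fin d → ℤ} (hl : |absPt h l - absPt h j| ≤ h) : u l = g l := by
        change u l = annularCutoff h R l * u l
        rw [annularCutoff_of_le, one_mul]
        linarith [abs_sub_le (absPt h l) (absPt h j) (R - 1 / 2)]
      exact .inr ⟨laplacianCommutator_congr
        (fun k => hneighbour (abs_absPt_add_unitVec_sub_le hh.le j k))
        fun k => hneighbour (abs_absPt_sub_unitVec_sub_le hh.le j k),
        abs_radialCutoff_differences_le hK hK' hh.le (by linarith) hR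
          (by linarith [(abs_lt.1 hnear).2])⟩
  calc _ ≤ 3 * d * ((3 * K * h) ^ 2 * (2 * dirichletForm g) +
          d * (19 * K * h ^ 2) ^ 2 * ∑' j, g j ^ 2) := by
        simpa only [Fintype.card_fin] using
          tsum_sq_laplacianCommutator_le_dirichletForm hg_fin hlocal
    _ ≤ 3 * d * ((3 * K * h) ^ 2 * (2 * ((d * (3 * K * h) ^ 2 + h ^ 2 * M) *
          ∑' j, annulusDensity h R u j)) +
          d * (19 * K * h ^ 2) ^ 2 * ∑' j, annulusDensity h R u j) := by
        gcongr
        exact dirichletForm_annularCutoff_mul_le hK hh hh' hV hu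
    _ = _ := by ring

theorem exists_ballMass_le_of_le_one_tenth (i : Fin d) (M : ℝ) :
    ∃ K : ℝ, ∀ h R Θ : ℝ, 0 < h → h ≤ 1 / 10 → 3 ≤ R → 0 ≤ Θ →
      h ^ 4 * (M ^ 2 + 1) ≤ 4 * Real.sinh (Θ / ((R + 1) / h)) * Real.sinh Θ ^ 2 →
      ∀ V u : (Fin d → ℤ) → ℝ, (∀ j, |V j| ≤ M) →
        (∀ j, discreteLaplacian h u j + V j * u j = 0) →
        ballMass h (R - 1) u ≤ Real.exp (10 * (Θ * ((R + 1) / h))) * (K * annulusMass h R u) := by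
  obtain ⟨K, hK, hK'⟩ := exists_lipschitzWith_smoothTransition
  refine ⟨3 * d * (18 * K ^ 2 * (9 * d * K ^ 2 + M) + 361 * d * K ^ 2),
    fun h R Θ hh hh' hR hΘ hM V u hV hu => ?_⟩
  have hbound := ballMass_le_of_cutoff i hh (by linarith) hΘ hM hV hu
    (fun j hj => radialCutoff_of_le_sub_one (by linarith) hj.le)
    (fun j hj => radialCutoff_of_le (by linarith) (by linarith))
    (tsum_sq_laplacianCommutator_radialCutoff_le hK hK' hh hh' hR hV hu)
  refine le_of_mul_le_mul_left (hbound.trans_eq ?_) (pow_pos hh 4)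
  ring

end SmoothCutoff

section LowerBounds

variable {d : ℕ}

lemma annulusMass_nonneg {h : ℝ} (hh : 0 ≤ h) (R : ℝ) (u : (Fin d → ℤ) → ℝ) :
    0 ≤ annulusMass h R u :=
  mul_nonneg (pow_nonneg hh d) (tsum_nonneg fun _ => sq_nonneg _)

lemma exp_neg_le_of_le_exp_mul {a b c K A : ℝ} (hc : 0 < c) (hA : 0 ≤ A)
    (hcA : c ≤ Real.exp a * (K * A)) (hK : K ≤ c * Real.exp b) : Real.exp (-(a + b)) ≤ A := by
  have hle : c * 1 ≤ c * (A * Real.exp (a + b)) :=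
    calc c * 1 ≤ Real.exp a * (c * Real.exp b * A) := by
          rw [mul_one]
          exact hcA.trans (by gcongr)
      _ = c * (A * Real.exp (a + b)) := by rw [Real.exp_add]; ring
  rw [Real.exp_neg, inv_le_iff_one_le_mul₀ (Real.exp_pos _)]
  exact le_of_mul_le_mul_left hle hc

lemma rpow_one_third_pow_three {x : ℝ} (hx : 0 ≤ x) : (x ^ (1 / 3 : ℝ)) ^ 3 = x := by
  rw [← Real.rpow_mul_natCast hx]
  norm_num

lemma rpow_four_thirds {x : ℝ} (hx : 0 ≤ x) : x ^ (4 / 3 : ℝ) = x * x ^ (1 / 3 : ℝ) := by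
  rw [← Real.rpow_one_add' hx (by norm_num)]
  norm_num

lemma add_one_rpow_four_thirds_le {x : ℝ} (hx : 1 ≤ x) :
    (x + 1) ^ (4 / 3 : ℝ) ≤ 4 * x ^ (4 / 3 : ℝ) :=
  calc (x + 1) ^ (4 / 3 : ℝ) ≤ (2 * x) ^ (4 / 3 : ℝ) := by gcongr; linarith
    _ = 2 ^ (4 / 3 : ℝ) * x ^ (4 / 3 : ℝ) := Real.mul_rpow two_pos.le (by linarith)
    _ ≤ 2 ^ (2 : ℝ) * x ^ (4 / 3 : ℝ) := by
        gcongr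
        · exact one_le_two
        · norm_num
    _ = 4 * x ^ (4 / 3 : ℝ) := by norm_num

lemma pow_four_mul_le_sinh_mul_sinh_sq {κ h r : ℝ} (hκ : 1 ≤ κ) (hh : 0 < h) (hr : 0 < r) :
    h ^ 4 * κ ≤ 4 * Real.sinh (κ * h * r / (r ^ 3 / h)) * Real.sinh (κ * h * r) ^ 2 := by
  have : 0 < κ := by linarith
  have hsinh {x : ℝ} (hx : 0 ≤ x) : x ≤ Real.sinh x := Real.self_le_sinh_iff.2 hx
  calc h ^ 4 * κ ≤ h ^ 4 * (4 * κ ^ 3) := by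
        gcongr
        nlinarith [one_le_pow₀ hκ (n := 2)]
    _ = 4 * (κ * h * r / (r ^ 3 / h)) * (κ * h * r) ^ 2 := by field_simp
    _ ≤ _ := by
        gcongr
        · exact hsinh (by positivity)
        · exact hsinh (by positivity)

theorem exists_forall_exp_le_annulusMass_of_mul_rpow_le_one (i : Fin d) (M c : ℝ) (hc : 0 < c) :
    ∃ R₀ : ℝ, 0 < R₀ ∧ ∀ h R : ℝ, 0 < h → R₀ ≤ R → h * R ^ (1 / 3 : ℝ) ≤ 1 →
      ∀ V u : (Fin d → ℤ) → ℝ, (∀ j, |V j| ≤ M) →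
        (∀ j, discreteLaplacian h u j + V j * u j = 0) → c ≤ ballMass h (R - 1) u →
        Real.exp (-(41 * (M ^ 2 + 1)) * R ^ (4 / 3 : ℝ)) ≤ annulusMass h R u := by
  obtain ⟨K, hK⟩ := exists_ballMass_le_of_le_one_tenth i M
  refine ⟨1000 + |K| / c, by positivity, fun h R hh hR hhR V u hV hu hball => ?_⟩
  have hKc : 0 ≤ |K| / c := by positivity
  have hR₀ : 0 ≤ R := by linarith
  have hmesh : h ≤ 1 / 10 := by
    have hroot : 10 ≤ R ^ (1 / 3 : ℝ) := by
      refine le_of_pow_le_pow_left₀ three_ne_zero (by positivity) ?_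
      rw [rpow_one_third_pow_three hR₀]
      linarith
    nlinarith
  set κ := M ^ 2 + 1
  have hκ₁ : 1 ≤ κ := by nlinarith [sq_nonneg M]
  set r := (R + 1) ^ (1 / 3 : ℝ) with hr
  have hr₀ : 0 < r := Real.rpow_pos_of_pos (by linarith) _
  have hr₃ : r ^ 3 = R + 1 := rpow_one_third_pow_three (by linarith)
  have hsinh := pow_four_mul_le_sinh_mul_sinh_sq hκ₁ hh hr₀
  rw [hr₃] at hsinh
  have hcarleman := hK h R (κ * h * r) hh hmesh (by linarith) (by positivity) hsinh V u hV hu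
  have hexponent : κ * h * r * ((R + 1) / h) = κ * (R + 1) ^ (4 / 3 : ℝ) := by
    rw [rpow_four_thirds (by linarith), ← hr]
    field_simp
  have hself : R ≤ R ^ (4 / 3 : ℝ) := Real.self_le_rpow_of_one_le (by linarith) (by norm_num)
  have hK_le : K ≤ c * Real.exp (κ * R ^ (4 / 3 : ℝ)) := by
    rw [← div_le_iff₀' hc]
    calc K / c ≤ |K| / c := by gcongr; exact le_abs_self K
      _ ≤ κ * R ^ (4 / 3 : ℝ) := by nlinarith
      _ ≤ _ := by linarith [Real.add_one_le_exp (κ * R ^ (4 / 3 : ℝ))]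
  refine le_trans (Real.exp_le_exp.2 ?_)
    (exp_neg_le_of_le_exp_mul hc (annulusMass_nonneg hh.le R u) (hball.trans hcarleman) hK_le)
  rw [hexponent]
  linear_combination 10 * κ * add_one_rpow_four_thirds_le (x := R) (by linarith)

lemma pow_four_mul_le_sinh_log_mul_sinh_log_sq {h R M : ℝ} (hh : 0 < h) (hh' : h < 3 / 2)
    (hRh : 9 ≤ R * h) (hR : 24 * (M ^ 2 + 1) ≤ R) :
    h ^ 4 * (M ^ 2 + 1) ≤ 4 * Real.sinh (Real.log (R * h) / ((R + 1) / h)) *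
      Real.sinh (Real.log (R * h)) ^ 2 := by
  have hR₁ : 1 ≤ R := by nlinarith [sq_nonneg M]
  have hlog : 1 ≤ Real.log (R * h) := by
    rw [Real.le_log_iff_exp_le (by linarith)]
    linarith [Real.exp_one_lt_d9]
  have hslope : h / (2 * R) ≤ Real.sinh (Real.log (R * h) / ((R + 1) / h)) :=
    calc h / (2 * R) = 1 / (2 * R / h) := by field_simp
      _ ≤ Real.log (R * h) / ((R + 1) / h) := by gcongr; linarith
      _ ≤ _ := Real.self_le_sinh_iff.2 (by positivity)
  have hsinh : R * h / 4 ≤ Real.sinh (Real.log (R * h)) := by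
    rw [Real.sinh_log (by linarith)]
    have : (R * h)⁻¹ ≤ 1 := inv_le_one_of_one_le₀ (by linarith)
    linarith
  calc h ^ 4 * (M ^ 2 + 1) = h ^ 3 * (h * (M ^ 2 + 1)) := by ring
    _ ≤ h ^ 3 * (R / 8) := by
        gcongr
        nlinarith
    _ = 4 * (h / (2 * R)) * (R * h / 4) ^ 2 := by field_simp; norm_num
    _ ≤ _ := by gcongr

lemma four_mul_sq_le_mul_pow_four_mul_exp {D c h q y : ℝ} (hc : 0 < c) (hh : 0 < h)
    (hq : 0 < q) (hhq : 1 ≤ h * q) (hqD : 18 * D ^ 2 / c ≤ q ^ 2) (hy : 2 / 3 * q ^ 3 ≤ y) :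
    4 * D ^ 2 ≤ c * h ^ 4 * Real.exp y := by
  have hexp : (2 / 3 * q ^ 3) ^ 2 / 2 ≤ Real.exp y := by
    have := Real.quadratic_le_exp_of_nonneg (show 0 ≤ 2 / 3 * q ^ 3 by positivity)
    linarith [Real.exp_le_exp.2 hy, show 0 ≤ 2 / 3 * q ^ 3 by positivity]
  have hqD' : 18 * D ^ 2 ≤ c * q ^ 2 := by rwa [div_le_iff₀' hc] at hqD
  calc 4 * D ^ 2 ≤ 2 / 9 * (c * q ^ 2) * 1 := by linarith
    _ ≤ 2 / 9 * (c * q ^ 2) * (h * q) ^ 4 := by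
        gcongr
        exact one_le_pow₀ hhq
    _ = c * h ^ 4 * ((2 / 3 * q ^ 3) ^ 2 / 2) := by ring
    _ ≤ _ := by gcongr

theorem exists_forall_exp_le_annulusMass_of_one_lt_mul_rpow (i : Fin d) (M c : ℝ) (hc : 0 < c) :
    ∃ R₀ : ℝ, 1 < R₀ ∧ ∀ h R : ℝ, 0 < h → h < 3 / 2 → R₀ ≤ R → 1 < h * R ^ (1 / 3 : ℝ) →
      ∀ V u : (Fin d → ℤ) → ℝ, (∀ j, |V j| ≤ M) →
        (∀ j, discreteLaplacian h u j + V j * u j = 0) → c ≤ ballMass h (R - 1) u →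
        Real.exp (-21 * (R / h) * Real.log (R * h)) ≤ annulusMass h R u := by
  have hM := sq_nonneg M
  set p := 3 + 18 * (d : ℝ) ^ 2 / c
  have hp₀ : 0 ≤ 18 * (d : ℝ) ^ 2 / c := by positivity
  have hp₃ : 0 < p ^ 3 := by positivity
  refine ⟨p ^ 3 + 24 * (M ^ 2 + 1), by linarith,
    fun h R hh hh' hR hhR V u hV hu hball => ?_⟩
  have hR₀ : 0 < R := by linarith
  set q := R ^ (1 / 3 : ℝ)
  have hq₃ : q ^ 3 = R := rpow_one_third_pow_three hR₀.le
  have hpq : p ≤ q := le_of_pow_le_pow_left₀ three_ne_zero (by positivity) (by linarith)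
  have hRh : 9 ≤ R * h :=
    calc (9 : ℝ) ≤ q ^ 2 * 1 := by nlinarith
      _ ≤ q ^ 2 * (h * q) := by gcongr
      _ = R * h := by rw [← hq₃]; ring
  have hlog : 1 ≤ Real.log (R * h) := by
    rw [Real.le_log_iff_exp_le (by linarith)]
    linarith [Real.exp_one_lt_d9]
  have hcarleman := ballMass_le_of_lt_three_halves i hh hh' hR₀ (zero_le_one.trans hlog)
    (pow_four_mul_le_sinh_log_mul_sinh_log_sq hh hh' hRh (by linarith)) hV hu
  have hy : 2 / 3 * q ^ 3 ≤ R / h * Real.log (R * h) :=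
    calc 2 / 3 * q ^ 3 = R / (3 / 2) * 1 := by rw [hq₃]; ring
      _ ≤ R / h * Real.log (R * h) := by gcongr
  have hK := four_mul_sq_le_mul_pow_four_mul_exp (D := d) hc hh (by linarith) hhR.le
    (by nlinarith) hy
  have hball' : c * h ^ 4 ≤ h ^ 4 * ballMass h (R - 1) u := by rw [mul_comm]; gcongr
  refine le_trans (Real.exp_le_exp.2 ?_) (exp_neg_le_of_le_exp_mul (by positivity)
    (annulusMass_nonneg hh.le R u) (hball'.trans hcarleman) hK)
  have hdouble : Real.log (R * h) * ((R + 1) / h) ≤ Real.log (R * h) * (2 * R / h) := by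
    gcongr
    linarith
  linear_combination 10 * hdouble

lemma exists_exponent {h R : ℝ} (hh : 0 < h) (hh₁ : h < 1) (hR : 1 < R)
    (hhR : 1 < h * R ^ (1 / 3 : ℝ)) :
    ∃ β : ℝ, 3 < β ∧ R = h ^ (-β) ∧ R ^ (1 + 1 / β) = R / h ∧ R ^ (1 - 1 / β) = R * h := by
  have hR₀ : 0 < R := by linarith
  have hlog_h : Real.log h < 0 := Real.log_neg hh hh₁
  have hlog_pos : 0 < Real.log h + 1 / 3 * Real.log R := by
    have := Real.log_pos hhR
    rwa [Real.log_mul hh.ne' (Real.rpow_pos_of_pos hR₀ _).ne', Real.log_rpow hR₀] at this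
  have hRβ : R = h ^ (-(-(Real.log R / Real.log h))) := by
    rw [neg_neg, Real.rpow_def_of_pos hh, mul_div_cancel₀ _ hlog_h.ne, Real.exp_log hR₀]
  have hβ : 3 < -(Real.log R / Real.log h) := by
    rw [← div_neg, lt_div_iff₀ (by linarith)]
    linarith
  have hinv : R ^ (1 / -(Real.log R / Real.log h)) = h⁻¹ := by
    nth_rw 1 [hRβ]
    rw [← Real.rpow_mul hh.le, neg_mul, mul_one_div_cancel (by linarith), Real.rpow_neg_one]
  refine ⟨-(Real.log R / Real.log h), hβ, hRβ, ?_, ?_⟩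
  · rw [Real.rpow_add hR₀, Real.rpow_one, hinv, div_eq_mul_inv]
  · rw [Real.rpow_sub hR₀, Real.rpow_one, hinv, div_inv_eq_mul]

lemma pow_mul_sq_abs_le_ballMass {h r : ℝ} (hh : 0 < h) (u : (Fin d → ℤ) → ℝ) {j : Fin d → ℤ}
    (hj : absPt h j < r) : h ^ d * |u j| ^ 2 ≤ ballMass h r u := by
  have : Finite {j : Fin d → ℤ // absPt h j < r} := (finite_absPt_lt hh r).to_subtype
  refine mul_le_mul_of_nonneg_left ?_ (by positivity)
  exact (Summable.of_finite (f := fun j : {j : Fin d → ℤ // absPt h j < r} => |u j| ^ 2)).le_tsum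
    ⟨j, hj⟩ fun _ _ => by positivity

theorem exists_forall_exp_le_annulusMass_of_ne_zero (i : Fin d) {h M : ℝ} (hh : 0 < h)
    (hh' : h < 3 / 2) {V u : (Fin d → ℤ) → ℝ} (hV : ∀ j, |V j| ≤ M)
    (hu : ∀ j, discreteLaplacian h u j + V j * u j = 0) (hne : u ≠ 0) :
    ∃ R₀ : ℝ, 0 < R₀ ∧ ∀ R : ℝ, R₀ ≤ R →
      Real.exp (-21 * (R / h) * Real.log (R * h)) ≤ annulusMass h R u := by
  obtain ⟨j, hj⟩ := Function.ne_iff.1 hne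
  have hj' : 0 < |u j| := abs_pos.2 hj
  obtain ⟨R₀, hR₀, hlower⟩ := exists_forall_exp_le_annulusMass_of_one_lt_mul_rpow i M
    (h ^ d * |u j| ^ 2) (by positivity)
  have hpt := absPt_nonneg h j
  have hinv : 0 < h⁻¹ ^ 3 := by positivity
  refine ⟨R₀ + (absPt h j + 2) + h⁻¹ ^ 3, by linarith, fun R hR => ?_⟩
  refine hlower h R hh hh' (by linarith) ?_ V u hV hu
    (pow_mul_sq_abs_le_ballMass hh u (by linarith))
  rw [← inv_lt_iff_one_lt_mul₀' hh]
  refine lt_of_pow_lt_pow_left₀ 3 (Real.rpow_nonneg (by linarith) _) ?_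
  rw [rpow_one_third_pow_three (by linarith)]
  linarith

end LowerBounds

end LatticeSchrodinger

theorem theorem1p6_general (d : ℕ) (hd : 1 ≤ d) :
    (∀ M : ℝ, ∃ C : ℝ, 0 < C ∧ ∀ c : ℝ, 0 < c → ∃ R₀ : ℝ, 0 < R₀ ∧
      ∀ h R : ℝ, 0 < h → R₀ ≤ R → h * R ^ (1 / 3 : ℝ) ≤ 1 →
      ∀ V u : (Fin d → ℤ) → ℝ, (∀ j, |V j| ≤ M) →
        (∀ j, LatticeSchrodinger.discreteLaplacian h u j + V j * u j = 0) →
        c ≤ LatticeSchrodinger.ballMass h (R - 1) u →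
        Real.exp (-C * R ^ (4 / 3 : ℝ)) ≤ LatticeSchrodinger.annulusMass h R u) ∧
    (∃ C : ℝ, 0 < C ∧
      (∀ M c : ℝ, 0 < c → ∃ R₀ : ℝ, 0 < R₀ ∧
        ∀ h R : ℝ, 0 < h → R₀ ≤ R → 1 < h * R ^ (1 / 3 : ℝ) →
        ∀ V u : (Fin d → ℤ) → ℝ, (∀ j, |V j| ≤ M) →
          (∀ j, LatticeSchrodinger.discreteLaplacian h u j + V j * u j = 0) →
          c ≤ LatticeSchrodinger.ballMass h (R - 1) u →
          (h < 1 → ∃ β : ℝ, 3 < β ∧ R = h ^ (-β) ∧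
            Real.exp (-C * R ^ (1 + 1 / β) * Real.log (R ^ (1 - 1 / β))) ≤
              LatticeSchrodinger.annulusMass h R u) ∧
          (h < 3 / 2 →
            Real.exp (-C * (R / h) * Real.log (R * h)) ≤
              LatticeSchrodinger.annulusMass h R u)) ∧
      (∀ h : ℝ, 0 < h → h < 3 / 2 →
        ∀ V u : (Fin d → ℤ) → ℝ, (∃ M : ℝ, ∀ j, |V j| ≤ M) →
          (∀ j, LatticeSchrodinger.discreteLaplacian h u j + V j * u j = 0) → u ≠ 0 →
          ∃ R₀ : ℝ, 0 < R₀ ∧ ∀ R : ℝ, R₀ ≤ R →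
            Real.exp (-C * (R / h) * Real.log (R * h)) ≤
              LatticeSchrodinger.annulusMass h R u)) := by
  have i : Fin d := ⟨0, hd⟩
  refine ⟨fun M => ⟨41 * (M ^ 2 + 1), by positivity, fun c hc =>
    LatticeSchrodinger.exists_forall_exp_le_annulusMass_of_mul_rpow_le_one i M c hc⟩,
    21, by norm_num, fun M c hc => ?_, ?_⟩
  · obtain ⟨R₀, hR₀, hcoarse⟩ :=
      LatticeSchrodinger.exists_forall_exp_le_annulusMass_of_one_lt_mul_rpow i M c hc
    refine ⟨R₀, by linarith, fun h R hh hR hhR V u hV hu hball =>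
      ⟨fun hh₁ => ?_, fun hh' => hcoarse h R hh hh' hR hhR V u hV hu hball⟩⟩
    obtain ⟨β, hβ, hRβ, hpow, hpow'⟩ :=
      LatticeSchrodinger.exists_exponent hh hh₁ (hR₀.trans_le hR) hhR
    refine ⟨β, hβ, hRβ, ?_⟩
    rw [hpow, hpow']
    exact hcoarse h R hh (by linarith) hR hhR V u hV hu hball
  · rintro h hh hh' V u ⟨M, hV⟩ hu hne
    exact LatticeSchrodinger.exists_forall_exp_le_annulusMass_of_ne_zero i hh hh' hV hu hne

theorem theorem1p6 (d : ℕ) (hd : 1 ≤ d) :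
    -- case `h R^{1/3} ≤ 1`: `C = C(d, ‖V‖_∞)`, `R₀ = R₀(d, ‖V‖_∞, c)`
    (∀ M : ℝ, ∃ C : ℝ, 0 < C ∧ ∀ c : ℝ, 0 < c → ∃ R₀ : ℝ, 0 < R₀ ∧
      ∀ h R : ℝ, 0 < h → R₀ ≤ R → h * R ^ (1 / 3 : ℝ) ≤ 1 →
      ∀ V u : (Fin d → ℤ) → ℝ, (∀ j, |V j| ≤ M) → LatticeSchrodinger.IsSolution h V u →
        c ≤ LatticeSchrodinger.ballMass h (R - 1) u →
        Real.exp (-C * R ^ (4 / 3 : ℝ)) ≤ LatticeSchrodinger.annulusMass h R u) ∧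
    -- case `h R^{1/3} > 1`: `C = C(d)`
    (∃ C : ℝ, 0 < C ∧
      -- `R₀ = R₀(d, ‖V‖_∞, c)`, uniformly in `h`
      (∀ M c : ℝ, 0 < c → ∃ R₀ : ℝ, 0 < R₀ ∧
        ∀ h R : ℝ, 0 < h → R₀ ≤ R → 1 < h * R ^ (1 / 3 : ℝ) →
        ∀ V u : (Fin d → ℤ) → ℝ, (∀ j, |V j| ≤ M) → LatticeSchrodinger.IsSolution h V u →
          c ≤ LatticeSchrodinger.ballMass h (R - 1) u →
          (h < 1 → ∃ β : ℝ, 3 < β ∧ R = h ^ (-β) ∧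
            Real.exp (-C * R ^ (1 + 1 / β) * Real.log (R ^ (1 - 1 / β))) ≤
              LatticeSchrodinger.annulusMass h R u) ∧
          (h < 3 / 2 →
            Real.exp (-C * (R / h) * Real.log (R * h)) ≤
              LatticeSchrodinger.annulusMass h R u)) ∧
      -- one nontrivial solution on one fixed lattice, `R` large
      (∀ h : ℝ, 0 < h → h < 3 / 2 →
        ∀ V u : (Fin d → ℤ) → ℝ, (∃ M : ℝ, ∀ j, |V j| ≤ M) →
          LatticeSchrodinger.IsSolution h V u → u ≠ 0 →
          ∃ R₀ : ℝ, 0 < R₀ ∧ ∀ R : ℝ, R₀ ≤ R →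
            Real.exp (-C * (R / h) * Real.log (R * h)) ≤
              LatticeSchrodinger.annulusMass h R u)) := by
  refine (?_ : _ → _) (theorem1p6_general d hd)
  gcongr <;> exact And.right
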